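/- Let $S$ be a set (of "filters") with a $p$-table, i.e. a function $S\times S\to[0,1]$, $(x,y)\mapsto x(y)$. Write $x\perp y$ if $x(y)=0$, let $d(x,y)=\sup_{z\in S}|x(z)-y(z)|$, and call a maximal set of mutually orthogonal elements of $S$ a frame. A two-dimensional subspace (qubit) is a set $P=\{z\in S: c(z)+c'(z)=1\}$ with $c\perp c'$. $S$ has dimension $N$ if there are mutually orthogonal $x_1,\dots,x_N\in S$ with $\sum_{j=1}^N x_j(z)=1$ for all $z\in S$. Assume: (I) $w(z)=1$ if and only if $w=z$, and $w(z)=z(w)$, for all $w,z\in S$. (II) $S$ is compact in the metric $d$. (III) $\sum_{x\in F}a(x)=1$ for every $a\in S$ and every frame $F$. (IV) For all $a\neq b$ in $S$ there are $c\perp c'$ in $S$ and $0<\alpha<1$ such that $a(c)\,c(z)+a(c')\,c'(z)=\alpha\,a(z)+(1-\alpha)\,b(z)$ for all $z\in S$. (V) The purities of the mixed states resulting from random measurements of a pure qubit state are uniformly distributed: for every two-dimensional subspace $P$ there is a Borel probability measure $\mu$ on $(P,d)$, invariant under all bijections $g:P\to P$ with $g(x)(g(y))=x(y)$ for all $x,y\in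 P$, such that for every $x\in P$ the purity $|2x(y)-1|$ of the state $x(y)\,y+(1-x(y))\,y'$, obtained by measuring $x$ in the frame $\{y,y'\}$ of $P$ with $y$ chosen at random according to $\mu$, is uniformly distributed on $[0,1]$. Then $S$ has a finite dimension, and whenever $S$ has dimension $N$, there is a map $z\mapsto\bar z$ from $S$ to the complex projective space $\mathbb{C}P^{N-1}$ such that the Born Rule $$x(y)=|\hat x^*\cdot\hat y|^2$$ holds for all $x,y\in S$, where $\hat z=\bar z/|\bar z|$ is the unit vector obtained by normalizing homogeneous coordinates of $\bar z$. -/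

import Mathlib

open MeasureTheory
open scoped LinearAlgebra.Projectivization

noncomputable section

/-- A `p`-table on a set `S` of filters: a function `x(y) = p(x, y)` with values in `[0, 1]`. -/
structure PTable (S : Type*) where
  /-- The probability `x(y)`. -/
  prob : S → S → ℝ
  prob_nonneg : ∀ x y, 0 ≤ prob x y
  prob_le_one : ∀ x y, prob x y ≤ 1

namespace PTable

variable {S : Type*} (p : PTable S)

/-- `x ⊥ y`, that is, `x(y) = 0`. -/
def Orthogonal (x y : S) : Prop := p.prob x y = 0

/-- A frame of `S`: a maximal set of mutually orthogonal elements. -/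
def IsFrame (F : Set S) : Prop :=
  Maximal (fun G : Set S => G.Pairwise p.Orthogonal) F

/-- `d(x, y) = sup_z |x(z) - y(z)|`. -/
def d (x y : S) : ℝ := ⨆ z, |p.prob x z - p.prob y z|

theorem abs_sub_le_one (x y z : S) : |p.prob x z - p.prob y z| ≤ 1 := by
  have h1 := p.prob_nonneg x z
  have h2 := p.prob_nonneg y z
  have h3 := p.prob_le_one x z
  have h4 := p.prob_le_one y z
  rw [abs_le]
  constructor <;> linarith

theorem bddAbove_d (x y : S) :
    BddAbove (Set.range fun z => |p.prob x z - p.prob y z|) := by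
  refine ⟨1, ?_⟩
  rintro _ ⟨z, rfl⟩
  exact p.abs_sub_le_one x y z

theorem d_triangle (x y z : S) : p.d x z ≤ p.d x y + p.d y z := by
  have : Nonempty S := ⟨x⟩
  refine ciSup_le fun w => ?_
  exact (abs_sub_le _ (p.prob y w) _).trans
    (add_le_add (le_ciSup (p.bddAbove_d x y) w) (le_ciSup (p.bddAbove_d y z) w))

/-- `S` with the distance `d` (a metric as soon as the first axiom holds). -/
abbrev pseudoMetric : PseudoMetricSpace S where
  dist := p.d
  dist_self x := by simp [d]
  dist_comm x y := by simp only [d, abs_sub_comm]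
  dist_triangle := p.d_triangle

/-- The topology of the `d`-metric. -/
abbrev topology : TopologicalSpace S := p.pseudoMetric.toUniformSpace.toTopologicalSpace

/-- The Borel `σ`-algebra of the `d`-metric, on a subset `P` of `S`. -/
abbrev borelOn (P : Set S) : MeasurableSpace P :=
  (@borel S p.topology).comap Subtype.val

/-- `S` is spanned by the `N` mutually orthogonal elements of some family, that is,
`∑ j, x_j(z) = 1` for every `z`: the dimension of `S` is `N`. -/
def HasDimension (N : ℕ) : Prop :=
  ∃ x : Fin N → S, (∀ i j, i ≠ j → p.Orthogonal (x i) (x j)) ∧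
    ∀ z, ∑ j, p.prob (x j) z = 1

/-- A two-dimensional subspace (a qubit): all `z` with `c(z) + c'(z) = 1`, for some pair of
orthogonal elements `c, c'`. -/
def IsQubit (P : Set S) : Prop :=
  ∃ c c' : S, p.Orthogonal c c' ∧ P = {z | p.prob c z + p.prob c' z = 1}

/-- The measurement of `x` in the frame `{y, y'}` of a two-dimensional subspace gives the mixed
state `q y + (1 - q) y'` with `q = x(y)`; its purity is `|2 q - 1|`. -/
def purity (x y : S) : ℝ := |2 * p.prob x y - 1|

/-- `μ` is a law of a random frame `{y, y'}` of `P` (given through its member `y`): a Borel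
probability measure on `P` that is invariant under all symmetries of the `p`-table of `P`. -/
def IsRandomLaw (P : Set S) (μ : @Measure P (p.borelOn P)) : Prop :=
  letI : MeasurableSpace P := p.borelOn P
  IsProbabilityMeasure μ ∧
    ∀ g : P ≃ P, (∀ x y : P, p.prob (g x) (g y) = p.prob x y) → MeasurePreserving g μ μ

/-- Axiom I: the table is symmetric, with the value `1` exactly on the diagonal. -/
def AxiomI : Prop :=
  (∀ w z, p.prob w z = 1 ↔ w = z) ∧ ∀ w z, p.prob w z = p.prob z w

/-- Axiom II: `S` is compact in the `d`-metric. -/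
def AxiomII : Prop := @CompactSpace S p.topology

/-- Axiom III: every `a` is a probability distribution on every frame. -/
def AxiomIII : Prop :=
  ∀ a : S, ∀ F : Set S, p.IsFrame F → HasSum (fun x : F => p.prob a x) 1

/-- Axiom IV: for distinct `a, b` there are orthogonal `c, c'` and `0 < α < 1` such that
`a(c) c + a(c') c' = α a + (1 - α) b` as functions on `S`. -/
def AxiomIV : Prop :=
  ∀ a b : S, a ≠ b → ∃ c c' : S, p.Orthogonal c c' ∧ ∃ α : ℝ, 0 < α ∧ α < 1 ∧
    ∀ z, p.prob a c * p.prob c z + p.prob a c' * p.prob c' z =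
      α * p.prob a z + (1 - α) * p.prob b z

/-- Axiom V: the purities of the mixed states resulting from random measurements of a pure qubit
state are uniformly distributed on `[0, 1]`. -/
def AxiomV : Prop :=
  ∀ P : Set S, p.IsQubit P →
    letI : MeasurableSpace P := p.borelOn P
    ∃ μ : Measure P, p.IsRandomLaw P μ ∧
      ∀ x : P, μ.map (fun y : P => p.purity x y) = volume.restrict (Set.Icc (0 : ℝ) 1)

end PTable

/-- The unit vector `x̂ = x̄ / |x̄|` of a point `x̄` of `ℂP^(N-1)` (for a choice of homogeneous
coordinates, that is, up to a phase). -/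
def unitRep {N : ℕ} (u : ℙ ℂ (EuclideanSpace ℂ (Fin N))) : EuclideanSpace ℂ (Fin N) :=
  ((‖u.rep‖⁻¹ : ℝ) : ℂ) • u.rep

end

/-! ### Orthogonal sets, finite frames and the dimension -/

namespace PTable

variable {S : Type*} {p : PTable S}

/-! Locally, a qubit is a sphere in a Euclidean space. By Axiom IV the nonnegative multiples of the
Bloch vectors `2 x - σ` of a qubit with unit `σ` form a linear space (`IsUnit₂.exists_blochSpace`).
By Axiom V every Bloch coordinate has mean square 1/3, while the squared coordinates of a unit
vector sum to 1, so this space has dimension three (`IsUnit₂.bloch_dimension`).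

A linear functional maximal at a point of a Bloch sphere is a multiple of the coordinate along that
point (`IsUnit₂.apply_bloch_of_max`). Maximization therefore produces eigenvectors, and every linear
combination of the functions `p.prob x` has a spectral decomposition. The bilinear extension of the
table is thus positive semidefinite, and the table is the Gram matrix of a map `ι` into a real inner
product space (`exists_featureMap`).

Globally, fix a point e. In the desired model x = [1 : ζ] is a rank-one projector, whose
off-diagonal part relative to e encodes ζ; this defines `Chart.η` from `ι` alone. A qubit through e
becomes a plane, and projection to it scales squared lengths by a transition probability
(`IsTriple.conformal`). Sums from orthogonal planes are attained, so the range of `η` is a linear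
space. The quarter turn of each vector in its plane is defined up to its sense; symmetry of the
table makes it self-adjoint up to signs, hence linear up to signs (`exists_linearMap_eq_or_eq_neg`).
The resulting skew isometry J is the complex structure, and the Born rule holds for the normalized
vectors (1, η x), with (0, unit vector) for the points orthogonal to e. -/

theorem AxiomI.self (h1 : p.AxiomI) (x : S) : p.prob x x = 1 := (h1.1 x x).2 rfl

theorem AxiomI.symm (h1 : p.AxiomI) (x y : S) : p.prob x y = p.prob y x := h1.2 x y

theorem AxiomI.eq (h1 : p.AxiomI) {x y : S} (h : p.prob x y = 1) : x = y := (h1.1 x y).1 h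

theorem AxiomI.ne_of_orthogonal (h1 : p.AxiomI) {x y : S} (h : p.prob x y = 0) : x ≠ y := by
  rintro rfl
  rw [h1.self] at h
  exact one_ne_zero h

theorem abs_sub_le_d (x y z : S) : |p.prob x z - p.prob y z| ≤ p.d x y :=
  le_ciSup (p.bddAbove_d x y) z

theorem continuous_prob (h1 : p.AxiomI) (x : S) : @Continuous S ℝ p.topology _ (p.prob x) := by
  let := p.pseudoMetric
  refine continuous_iff_continuousAt.2 fun a => Metric.continuousAt_iff.2 fun ε hε => ⟨ε, hε, ?_⟩
  intro y hy
  rw [Real.dist_eq, h1.symm x y, h1.symm x a]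
  exact (abs_sub_le_d y a x).trans_lt hy

/-- Orthogonal points are at distance at least 1, because x(x) - y(x) = 1. A ball of radius 1/2 from
a finite cover therefore contains at most one of them. -/
theorem finite_of_pairwise_orthogonal (h1 : p.AxiomI) (h2 : p.AxiomII) {F : Set S}
    (hF : F.Pairwise p.Orthogonal) : F.Finite := by
  let := p.pseudoMetric
  have : CompactSpace S := h2
  obtain ⟨t, -, ht, hcov⟩ :=
    Metric.finite_approx_of_totallyBounded (s := (Set.univ : Set S))
      isCompact_univ.totallyBounded (1 / 2) (by norm_num)
  have hex : ∀ x : S, ∃ y ∈ t, dist x y < 1 / 2 := by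
    intro x
    simpa using hcov (Set.mem_univ x)
  choose g hg hd using hex
  refine Set.Finite.of_injOn (f := g) (fun x _ => hg x) ?_ ht
  intro x hx y hy hxy
  by_contra hne
  have hlt : dist x y < 1 := by
    have h3 := hd y
    rw [← hxy] at h3
    linarith [dist_triangle_right x y (g x), hd x]
  have hge := abs_sub_le_d (p := p) x y x
  rw [h1.self, h1.symm y x, show p.prob x y = 0 from hF hx hy hne, sub_zero, abs_one] at hge
  exact absurd hlt (not_lt.2 hge)

/-- A finite frame: orthogonal elements with total probability one at every point. -/
def IsFiniteFrame (p : PTable S) (F : Finset S) : Prop :=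
  (F : Set S).Pairwise p.Orthogonal ∧ ∀ z, ∑ c ∈ F, p.prob c z = 1

theorem exists_isFiniteFrame_superset (h1 : p.AxiomI) (h2 : p.AxiomII) (h3 : p.AxiomIII)
    {C : Finset S} (hC : (C : Set S).Pairwise p.Orthogonal) :
    ∃ F, p.IsFiniteFrame F ∧ C ⊆ F := by
  obtain ⟨F, hCF, hF⟩ := zorn_subset_nonempty {G : Set S | G.Pairwise p.Orthogonal}
    (fun c hc hchain _ => ⟨⋃₀ c, (Set.pairwise_sUnion hchain.directedOn).2 fun s hs => hc hs,
      fun s hs => Set.subset_sUnion_of_mem hs⟩) (C : Set S) hC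
  have hfin := finite_of_pairwise_orthogonal h1 h2 hF.prop
  lift F to Finset S using hfin
  refine ⟨F, ⟨hF.prop, fun z => ?_⟩, by exact_mod_cast hCF⟩
  have h := (h3 z (F : Set S) hF).tsum_eq
  rw [Finset.tsum_subtype' F (p.prob z)] at h
  rw [← h]
  exact Finset.sum_congr rfl fun c _ => h1.symm c z

/-- The sum of the table over the product of two frames, taken in either order, counts the members
of one frame or of the other. -/
theorem IsFiniteFrame.card_eq (h1 : p.AxiomI) {F G : Finset S} (hF : p.IsFiniteFrame F)
    (hG : p.IsFiniteFrame G) : F.card = G.card := by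
  have h : ∑ c ∈ F, ∑ d ∈ G, p.prob d c = ∑ d ∈ G, ∑ c ∈ F, p.prob c d := by
    rw [Finset.sum_comm]
    exact Finset.sum_congr rfl fun d _ => Finset.sum_congr rfl fun c _ => h1.symm d c
  simp only [hF.2, hG.2, Finset.sum_const, nsmul_eq_mul, mul_one] at h
  exact_mod_cast h

theorem exists_hasDimension (h1 : p.AxiomI) (h2 : p.AxiomII) (h3 : p.AxiomIII) :
    ∃ N : ℕ, p.HasDimension N := by
  obtain ⟨F, hF, -⟩ := exists_isFiniteFrame_superset (C := ∅) h1 h2 h3 (by simp)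
  refine ⟨F.card, fun j => F.equivFin.symm j, fun i j hij => ?_, fun z => ?_⟩
  · exact hF.1 (F.equivFin.symm i).2 (F.equivFin.symm j).2
      fun h => hij (F.equivFin.symm.injective (Subtype.ext h))
  · rw [← hF.2 z, Equiv.sum_comp F.equivFin.symm (fun c : F => p.prob c z)]
    exact Finset.sum_coe_sort F fun c => p.prob c z

theorem pairwise_orthogonal_insert (h1 : p.AxiomI) [DecidableEq S] {C : Finset S} {x : S}
    (hC : (C : Set S).Pairwise p.Orthogonal) (hx : ∀ c ∈ C, p.prob c x = 0) :
    ((insert x C : Finset S) : Set S).Pairwise p.Orthogonal := by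
  rw [Finset.coe_insert]
  refine hC.insert fun c hc _ => ⟨?_, hx c hc⟩
  exact (h1.symm x c).trans (hx c hc)

theorem pairwise_orthogonal_pair (h1 : p.AxiomI) [DecidableEq S] {c c' : S}
    (h : p.prob c c' = 0) : (({c, c'} : Finset S) : Set S).Pairwise p.Orthogonal :=
  pairwise_orthogonal_insert h1 (by simp) (by simpa using (h1.symm c' c).trans h)

/-! ### Qubits and the mixtures of Axiom IV -/

/-- The unit of a qubit: a sum of two orthogonal elements, as a function on `S`. -/
def IsUnit₂ (p : PTable S) (σ : S → ℝ) : Prop :=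
  ∃ c c' : S, p.Orthogonal c c' ∧ σ = p.prob c + p.prob c'

/-- Every qubit unit is completed to the constant `1` by a finite orthogonal set, and every
orthogonal pair in a qubit has the same unit. -/
theorem IsUnit₂.exists_rest (h1 : p.AxiomI) (h2 : p.AxiomII) (h3 : p.AxiomIII) {σ : S → ℝ}
    (hσ : p.IsUnit₂ σ) : ∃ R : Finset S, (R : Set S).Pairwise p.Orthogonal ∧
      (∀ z, σ z + ∑ r ∈ R, p.prob r z = 1) ∧
      ∀ x, (∀ r ∈ R, p.prob r x = 0) → ∃ x', (∀ r ∈ R, p.prob r x' = 0) ∧ p.prob x x' = 0 ∧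
        p.prob x + p.prob x' = σ := by
  classical
  obtain ⟨c, c', hcc, rfl⟩ := hσ
  have hne := h1.ne_of_orthogonal hcc
  obtain ⟨F, hF, hsub⟩ := exists_isFiniteFrame_superset (C := {c, c'}) h1 h2 h3
    (pairwise_orthogonal_pair h1 hcc)
  have hc : c ∈ F := hsub (by simp)
  have hc' : c' ∈ F.erase c := Finset.mem_erase.2 ⟨hne.symm, hsub (by simp)⟩
  set R := (F.erase c).erase c' with hR
  have hRF : R ⊆ F := (Finset.erase_subset _ _).trans (Finset.erase_subset _ _)
  have hsum : ∀ z, p.prob c z + p.prob c' z + ∑ r ∈ R, p.prob r z = 1 := by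
    intro z
    rw [← hF.2 z, ← Finset.add_sum_erase F _ hc, ← Finset.add_sum_erase _ _ hc', add_assoc]
  have hcard : R.card + 2 = F.card := by
    rw [← Finset.card_erase_add_one hc, ← Finset.card_erase_add_one hc']
  refine ⟨R, hF.1.mono (by exact_mod_cast hRF), hsum, fun x hx => ?_⟩
  have hRo : (R : Set S).Pairwise p.Orthogonal := hF.1.mono (by exact_mod_cast hRF)
  have hxR : x ∉ R := fun h => h1.ne_of_orthogonal (hx x h) rfl
  obtain ⟨G, hG, hsubG⟩ := exists_isFiniteFrame_superset h1 h2 h3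
    (pairwise_orthogonal_insert h1 hRo hx)
  -- Frames are equinumerous, so exactly one element x' is missing from `insert x R`. The pairs c,
  -- c' and x, x' both complete R, hence have the same unit.
  have hcardG : G.card = (insert x R).card + 1 := by
    rw [hG.card_eq h1 hF, Finset.card_insert_of_notMem hxR, ← hcard]
  obtain ⟨x', hx'⟩ : ∃ x', G \ insert x R = {x'} := by
    rw [← Finset.card_eq_one, Finset.card_sdiff_of_subset hsubG]
    omega
  have hmem : x' ∈ G \ insert x R := by simp [hx']
  obtain ⟨hx'G, hx'n⟩ := Finset.mem_sdiff.1 hmem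
  rw [Finset.mem_insert, not_or] at hx'n
  refine ⟨x', fun r hr => ?_, ?_, ?_⟩
  · exact hG.1 (hsubG (Finset.mem_insert_of_mem hr)) hx'G fun h => hx'n.2 (h ▸ hr)
  · exact hG.1 (hsubG (Finset.mem_insert_self _ _)) hx'G fun h => hx'n.1 h.symm
  · funext z
    have h := hG.2 z
    rw [← Finset.sum_sdiff hsubG, hx', Finset.sum_singleton, Finset.sum_insert hxR] at h
    simp only [Pi.add_apply]
    linarith [hsum z]

theorem IsUnit₂.exists_compl (h1 : p.AxiomI) (h2 : p.AxiomII) (h3 : p.AxiomIII) {σ : S → ℝ}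
    (hσ : p.IsUnit₂ σ) {x : S} (hx : σ x = 1) :
    ∃ x', σ x' = 1 ∧ p.prob x x' = 0 ∧ p.prob x + p.prob x' = σ := by
  obtain ⟨R, -, hsum, hR⟩ := hσ.exists_rest h1 h2 h3
  have h0 : ∀ r ∈ R, p.prob r x = 0 := by
    have h := hsum x
    rw [hx, add_eq_left, Finset.sum_eq_zero_iff_of_nonneg fun r _ => p.prob_nonneg r x] at h
    exact h
  obtain ⟨x', -, hxx, rfl⟩ := hR x h0
  exact ⟨x', by simp [hxx, h1.self], hxx, rfl⟩

theorem IsUnit₂.of_orthogonal {c c' : S} (h : p.prob c c' = 0) :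
    p.IsUnit₂ (p.prob c + p.prob c') := ⟨c, c', h, rfl⟩

/-- Axiom IV with the weights worked out: the mixture has equal weights. -/
theorem AxiomIV.exists_midpoint (h1 : p.AxiomI) (h2 : p.AxiomII) (h3 : p.AxiomIII)
    (h4 : p.AxiomIV) {a b : S} (hab : a ≠ b) :
    ∃ c c' : S, p.prob c c' = 0 ∧ ∃ l : ℝ, 0 < l ∧ l < 1 ∧
      p.prob a + p.prob b = (2 * l) • p.prob c + (2 * (1 - l)) • p.prob c' := by
  obtain ⟨c, c', hcc, α, h0, h1', h⟩ := h4 a b hab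
  have hcc' : p.prob c' c = 0 := (h1.symm c' c).trans hcc
  have hc : p.prob a c = p.prob b c := by
    have := h c
    rw [h1.self, hcc'] at this
    have h' : (1 - α) * (p.prob a c - p.prob b c) = 0 := by linarith
    rcases mul_eq_zero.1 h' with h' | h' <;> linarith
  have hc' : p.prob a c' = p.prob b c' := by
    have := h c'
    rw [h1.self, show p.prob c c' = 0 from hcc] at this
    have h' : (1 - α) * (p.prob a c' - p.prob b c') = 0 := by linarith
    rcases mul_eq_zero.1 h' with h' | h' <;> linarith
  have hablt : p.prob a b ≠ 1 := fun h => hab (h1.eq h)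
  -- The left side of the identity takes the same value at a and at b; the right sides are α + (1 -
  -- α) a(b) and α a(b) + (1 - α).
  have hα : α = 1 / 2 := by
    have ha := h a
    have hb := h b
    rw [h1.self, h1.symm c a, h1.symm c' a, h1.symm b a] at ha
    rw [h1.self, h1.symm c b, h1.symm c' b, ← hc, ← hc'] at hb
    have : (2 * α - 1) * (1 - p.prob a b) = 0 := by linarith
    rcases mul_eq_zero.1 this with h' | h'
    · linarith
    · exact absurd (by linarith) hablt
  subst hα
  -- Every function `p.prob x` sums to 1 over a frame, so the identity of Axiom IV is summed over
  -- one.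
  have hone : p.prob a c + p.prob a c' = 1 := by
    classical
    obtain ⟨F, hF, hsub⟩ := exists_isFiniteFrame_superset (C := {c, c'}) h1 h2 h3
      (pairwise_orthogonal_pair h1 hcc)
    have key : ∑ z ∈ F, (p.prob a c * p.prob c z + p.prob a c' * p.prob c' z) =
        ∑ z ∈ F, (1 / 2 * p.prob a z + (1 - 1 / 2) * p.prob b z) :=
      Finset.sum_congr rfl fun z _ => h z
    have hs : ∀ x, ∑ z ∈ F, p.prob x z = 1 := fun x => by
      rw [← hF.2 x]
      exact Finset.sum_congr rfl fun z _ => h1.symm x z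
    simp only [Finset.sum_add_distrib, ← Finset.mul_sum, hs] at key
    linarith
  refine ⟨c, c', hcc, p.prob a c, ?_, ?_, ?_⟩
  · refine lt_of_le_of_ne (p.prob_nonneg a c) fun h0 => hab ?_
    have e1 : p.prob a c' = 1 := by linarith
    exact (h1.eq e1).trans (h1.eq (hc'.symm.trans e1)).symm
  · refine lt_of_le_of_ne (p.prob_le_one a c) fun h0 => hab ?_
    exact (h1.eq h0).trans (h1.eq (hc.symm.trans h0)).symm
  · funext z
    simp only [Pi.add_apply, Pi.smul_apply, smul_eq_mul]
    have e := h z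
    rw [show p.prob a c' = 1 - p.prob a c by linarith] at e
    linarith

/-- Two distinct points span a qubit. -/
theorem AxiomIV.exists_unit (h1 : p.AxiomI) (h2 : p.AxiomII) (h3 : p.AxiomIII)
    (h4 : p.AxiomIV) {a b : S} (hab : a ≠ b) :
    ∃ σ, p.IsUnit₂ σ ∧ σ a = 1 ∧ σ b = 1 ∧
      ∀ y, p.prob y a = 0 → p.prob y b = 0 → σ y = 0 := by
  obtain ⟨c, c', hcc, l, hl0, hl1, h⟩ := h4.exists_midpoint h1 h2 h3 hab
  have hσ := IsUnit₂.of_orthogonal (p := p) hcc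
  obtain ⟨R, -, hsum, -⟩ := hσ.exists_rest h1 h2 h3
  have hv : ∀ r, p.prob a r + p.prob b r = 2 * l * p.prob c r + 2 * (1 - l) * p.prob c' r :=
    fun r => congrFun h r
  have hcr : ∀ r ∈ R, p.prob c r = 0 ∧ p.prob c' r = 0 := by
    intro r hr
    have e := hsum r
    have : p.prob r r ≤ ∑ s ∈ R, p.prob s r :=
      Finset.single_le_sum (f := fun s => p.prob s r) (fun s _ => p.prob_nonneg s r) hr
    rw [h1.self] at this
    simp only [Pi.add_apply] at e
    constructor <;> linarith [p.prob_nonneg c r, p.prob_nonneg c' r]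
  have hab0 : ∀ r ∈ R, p.prob a r = 0 ∧ p.prob b r = 0 := by
    intro r hr
    have := hv r
    rw [(hcr r hr).1, (hcr r hr).2] at this
    constructor <;> linarith [p.prob_nonneg a r, p.prob_nonneg b r]
  refine ⟨_, hσ, ?_, ?_, fun y hya hyb => ?_⟩
  · have := hsum a
    rwa [Finset.sum_eq_zero fun r hr => (h1.symm r a).trans (hab0 r hr).1, add_zero] at this
  · have := hsum b
    rwa [Finset.sum_eq_zero fun r hr => (h1.symm r b).trans (hab0 r hr).2, add_zero] at this
  · have := hv y
    rw [h1.symm a, h1.symm b, hya, hyb] at this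
    have e1 := mul_nonneg hl0.le (p.prob_nonneg c y)
    have e2 := mul_nonneg (sub_nonneg.2 hl1.le) (p.prob_nonneg c' y)
    have e3 : l * p.prob c y = 0 := by linarith
    have e4 : (1 - l) * p.prob c' y = 0 := by linarith
    have e5 := (mul_eq_zero.1 e3).resolve_left hl0.ne'
    have e6 := (mul_eq_zero.1 e4).resolve_left (sub_pos.2 hl1).ne'
    simp [e5, e6]

/-- Inside a qubit, the direction of the sum of two Bloch vectors is a Bloch vector. -/
theorem IsUnit₂.exists_add (h1 : p.AxiomI) (h2 : p.AxiomII) (h3 : p.AxiomIII)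
    (h4 : p.AxiomIV) {σ : S → ℝ} (hσ : p.IsUnit₂ σ) {a b : S} (ha : σ a = 1) (hb : σ b = 1) :
    ∃ c, σ c = 1 ∧ ∃ k : ℝ, 0 ≤ k ∧
      ((2 : ℝ) • p.prob a - σ) + ((2 : ℝ) • p.prob b - σ) = k • ((2 : ℝ) • p.prob c - σ) := by
  by_cases hab : a = b
  · subst hab
    exact ⟨a, ha, 2, by norm_num, by rw [two_smul ℝ (_ - _)]⟩
  obtain ⟨c, c', hcc, l, hl0, hl1, h⟩ := h4.exists_midpoint h1 h2 h3 hab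
  obtain ⟨R, hRo, hsum, hR⟩ := hσ.exists_rest h1 h2 h3
  have hv : ∀ r, p.prob a r + p.prob b r = 2 * l * p.prob c r + 2 * (1 - l) * p.prob c' r :=
    fun r => congrFun h r
  have h0 : ∀ x, σ x = 1 → ∀ r ∈ R, p.prob r x = 0 := by
    intro x hx
    have h := hsum x
    rwa [hx, add_eq_left, Finset.sum_eq_zero_iff_of_nonneg fun r _ => p.prob_nonneg r x] at h
  have hcr : ∀ r ∈ R, p.prob r c = 0 ∧ p.prob r c' = 0 := by
    intro r hr
    have := hv r
    rw [h1.symm a, h1.symm b, h0 a ha r hr, h0 b hb r hr] at this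
    have e1 := mul_nonneg hl0.le (p.prob_nonneg c r)
    have e2 := mul_nonneg (sub_nonneg.2 hl1.le) (p.prob_nonneg c' r)
    have e3 : l * p.prob c r = 0 := by linarith
    have e4 : (1 - l) * p.prob c' r = 0 := by linarith
    rw [h1.symm r c, h1.symm r c']
    exact ⟨(mul_eq_zero.1 e3).resolve_left hl0.ne',
      (mul_eq_zero.1 e4).resolve_left (sub_pos.2 hl1).ne'⟩
  have hσc : σ c = 1 := by
    have := hsum c
    rwa [Finset.sum_eq_zero fun r hr => (hcr r hr).1, add_zero] at this
  have hσc' : σ c' = 1 := by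
    have := hsum c'
    rwa [Finset.sum_eq_zero fun r hr => (hcr r hr).2, add_zero] at this
  have hs : p.prob c + p.prob c' = σ := by
    obtain ⟨x, -, hx, hxs⟩ := hR c fun r hr => (hcr r hr).1
    have e := congrFun hxs c'
    rw [Pi.add_apply, hcc, zero_add, hσc'] at e
    rw [← h1.eq e]
    exact hxs
  -- Since c + c' = σ, the sum of Bloch vectors is (4l - 2) times that of c. For l < 1/2 the sign is
  -- absorbed by passing to c'.
  rcases le_total (1 / 2) l with hl | hl
  · refine ⟨c, hσc, 4 * l - 2, by linarith, ?_⟩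
    funext z
    have e1 := hv z
    have e2 := congrFun hs z
    simp only [Pi.add_apply, Pi.sub_apply, Pi.smul_apply, smul_eq_mul] at e2 ⊢
    linear_combination 2 * e1 + 4 * (1 - l) * e2
  · refine ⟨c', hσc', 2 - 4 * l, by linarith, ?_⟩
    funext z
    have e1 := hv z
    have e2 := congrFun hs z
    simp only [Pi.add_apply, Pi.sub_apply, Pi.smul_apply, smul_eq_mul] at e2 ⊢
    linear_combination 2 * e1 + 4 * l * e2

end PTable

/-! ### The Bloch ball of a qubit -/

theorem Icc_subset_of_forall_exists_between {T : Set ℝ} (hT : IsClosed T) (h0 : (0 : ℝ) ∈ T)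
    (h1 : (1 : ℝ) ∈ T)
    (h : ∀ a ∈ T, ∀ b ∈ T, 0 ≤ a → a < b → b ≤ 1 → ∃ s ∈ T, a < s ∧ s < b) :
    Set.Icc 0 1 ⊆ T := by
  intro t ht
  by_contra htT
  -- The last point of T before t and the first one after it would bound a gap in T.
  obtain ⟨a, ⟨haT, ha⟩, hamax⟩ := (isCompact_Icc.inter_left hT).exists_isGreatest
    (s := T ∩ Set.Icc 0 t) ⟨0, h0, le_refl _, ht.1⟩
  obtain ⟨b, ⟨hbT, hb⟩, hbmin⟩ := (isCompact_Icc.inter_left hT).exists_isLeast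
    (s := T ∩ Set.Icc t 1) ⟨1, h1, ht.2, le_refl _⟩
  have hat : a < t := lt_of_le_of_ne ha.2 fun h => htT (h ▸ haT)
  have htb : t < b := lt_of_le_of_ne hb.1 fun h => htT (h ▸ hbT)
  obtain ⟨s, hsT, has, hsb⟩ := h a haT b hbT ha.1 (hat.trans htb) hb.2
  rcases le_total s t with hst | hst
  · exact absurd has (not_lt.2 (hamax ⟨hsT, ha.1.trans has.le, hst⟩))
  · exact absurd hsb (not_lt.2 (hbmin ⟨hsT, hst, hsb.le.trans hb.2⟩))

/-- The first-order term at t = 0 must vanish. It suffices to test t = a / (1 + a² + b): for a ≠ 0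
this would give 1 + a² + b ≤ b. -/
theorem eq_zero_of_forall_mul_le_sq_mul {a b : ℝ} (hb : 0 ≤ b)
    (h : ∀ t : ℝ, |t| ≤ 1 → t * a ≤ t ^ 2 * b) : a = 0 := by
  by_contra ha
  have hD : 0 < 1 + a ^ 2 + b := by positivity
  have h' := h (a / (1 + a ^ 2 + b)) (by
    rw [abs_div, abs_of_pos hD, div_le_one hD]
    nlinarith [sq_nonneg (|a| - 1), sq_abs a])
  rw [div_mul_eq_mul_div, div_pow, div_mul_eq_mul_div, div_le_div_iff₀ hD (by positivity)] at h'
  have ha2 : 0 < a ^ 2 := by positivity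
  have : a ^ 2 * (1 + a ^ 2 + b) * (1 + a ^ 2) ≤ 0 := by nlinarith
  exact absurd this (not_le.2 (by positivity))

namespace PTable

variable {S : Type*} {p : PTable S}

/-- The Bloch vector of `x` in the qubit with unit `σ`, as a function on `S`. -/
def bloch (p : PTable S) (σ : S → ℝ) (x : S) : S → ℝ := (2 : ℝ) • p.prob x - σ

theorem bloch_apply (σ : S → ℝ) (x y : S) : p.bloch σ x y = 2 * p.prob x y - σ y := rfl

theorem bloch_apply_of_mem {σ : S → ℝ} (x : S) {y : S} (hy : σ y = 1) :
    p.bloch σ x y = 2 * p.prob x y - 1 := by rw [bloch_apply, hy]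

theorem IsUnit₂.exists_bloch_neg (h1 : p.AxiomI) (h2 : p.AxiomII) (h3 : p.AxiomIII)
    {σ : S → ℝ} (hσ : p.IsUnit₂ σ) {x : S} (hx : σ x = 1) :
    ∃ x', σ x' = 1 ∧ p.bloch σ x' = - p.bloch σ x := by
  obtain ⟨x', hx', -, h⟩ := hσ.exists_compl h1 h2 h3 hx
  refine ⟨x', hx', ?_⟩
  funext z
  have := congrFun h z
  simp only [bloch_apply, Pi.neg_apply, Pi.add_apply] at this ⊢
  linarith

theorem IsUnit₂.continuous (h1 : p.AxiomI) {σ : S → ℝ} (hσ : p.IsUnit₂ σ) :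
    @Continuous S ℝ p.topology _ σ := by
  let := p.pseudoMetric
  obtain ⟨c, c', -, rfl⟩ := hσ
  exact (continuous_prob h1 c).add (continuous_prob h1 c')

/-- The parameters t with the required property form a closed set, by compactness, and `exists_add`
puts a further one between any two of them, so they fill the interval. Positivity of a(b) excludes
antipodal points and keeps the segment away from 0. -/
theorem IsUnit₂.exists_segment (h1 : p.AxiomI) (h2 : p.AxiomII) (h3 : p.AxiomIII)
    (h4 : p.AxiomIV) {σ : S → ℝ} (hσ : p.IsUnit₂ σ) {a b : S} (ha : σ a = 1) (hb : σ b = 1)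
    (hab : 0 < p.prob a b) {t : ℝ} (ht : t ∈ Set.Icc (0 : ℝ) 1) :
    ∃ r : ℝ, 0 ≤ r ∧ ∃ x, σ x = 1 ∧
      (1 - t) • p.bloch σ a + t • p.bloch σ b = r • p.bloch σ x := by
  let := p.pseudoMetric
  have : CompactSpace S := h2
  let v : ℝ → S → ℝ := fun t => (1 - t) • p.bloch σ a + t • p.bloch σ b
  -- Evaluation at x, where the Bloch vector of x equals 1, bounds the factor r. Hence the multiples
  -- with factor in [0, 1], which form a compact set, suffice.
  have hbound : ∀ t ∈ Set.Icc (0 : ℝ) 1, ∀ (r : ℝ) (x : S), σ x = 1 →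
      v t = r • p.bloch σ x → r ≤ 1 := by
    intro t ht r x hx h
    have e := congrFun h x
    simp only [v, Pi.add_apply, Pi.smul_apply, smul_eq_mul, bloch_apply_of_mem _ hx, h1.self] at e
    nlinarith [p.prob_le_one a x, p.prob_le_one b x, ht.1, ht.2]
  let K : Set (S → ℝ) := (fun q : ℝ × S => q.1 • p.bloch σ q.2) '' (Set.Icc 0 1 ×ˢ {x | σ x = 1})
  have hKc : IsCompact K := by
    refine (isCompact_Icc.prod
      ((isClosed_eq (hσ.continuous h1) continuous_const).isCompact)).image ?_
    refine continuous_pi fun z => ?_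
    have : Continuous fun q : ℝ × S => p.prob q.2 z := by
      simp only [h1.symm _ z]
      exact (continuous_prob h1 z).comp continuous_snd
    simp only [Pi.smul_apply, bloch_apply, smul_eq_mul]
    fun_prop
  have hv : Continuous v := by
    refine continuous_pi fun z => ?_
    simp only [v, Pi.add_apply, Pi.smul_apply, smul_eq_mul]
    fun_prop
  suffices hT : Set.Icc 0 1 ⊆ v ⁻¹' K by
    obtain ⟨⟨r, x⟩, ⟨hr, hx⟩, h⟩ := hT ht
    exact ⟨r, hr.1, x, hx, h.symm⟩
  refine Icc_subset_of_forall_exists_between (hKc.isClosed.preimage hv)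
    ⟨(1, a), ⟨by simp, ha⟩, by simp [v]⟩ ⟨(1, b), ⟨by simp, hb⟩, by simp [v]⟩ ?_
  rintro t₁ ⟨⟨r₁, x₁⟩, ⟨hr₁, hx₁⟩, e₁⟩ t₂ ⟨⟨r₂, x₂⟩, ⟨hr₂, hx₂⟩, e₂⟩ ht₁ hlt ht₂
  simp only at e₁ e₂ hr₁ hr₂
  have hx₁' : σ x₁ = 1 := hx₁
  have hx₂' : σ x₂ = 1 := hx₂
  have hne : ∀ (t r : ℝ) (x : S), v t = r • p.bloch σ x → r ≠ 0 := by
    rintro t r x e rfl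
    have ea := congrFun e a
    have eb := congrFun e b
    simp only [v, Pi.add_apply, Pi.smul_apply, smul_eq_mul, bloch_apply_of_mem _ ha,
      bloch_apply_of_mem _ hb, h1.self, h1.symm b a] at ea eb
    linarith
  have hp₁ : 0 < r₁ := lt_of_le_of_ne hr₁.1 (hne t₁ r₁ x₁ e₁.symm).symm
  have hp₂ : 0 < r₂ := lt_of_le_of_ne hr₂.1 (hne t₂ r₂ x₂ e₂.symm).symm
  obtain ⟨c, hc, k, hk, e⟩ := hσ.exists_add h1 h2 h3 h4 hx₁' hx₂'
  have hs : 0 < r₁ + r₂ := by positivity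
  -- The sum of the Bloch vectors of x₁ and x₂ is v t₁ / r₁ + v t₂ / r₂, a multiple of r₂ v t₁ + r₁
  -- v t₂ = (r₁ + r₂) v s.
  set s : ℝ := (t₁ * r₂ + t₂ * r₁) / (r₁ + r₂) with hsdef
  have hs₁ : t₁ < s := by
    rw [hsdef, lt_div_iff₀ hs]
    nlinarith
  have hs₂ : s < t₂ := by
    rw [hsdef, div_lt_iff₀ hs]
    nlinarith
  have hvs : v s = (k * (r₁ * r₂ / (r₁ + r₂))) • p.bloch σ c := by
    funext z
    have e1 := congrFun e₁ z
    have e2 := congrFun e₂ z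
    have e3 := congrFun e z
    simp only [v, Pi.add_apply, Pi.smul_apply, Pi.sub_apply, smul_eq_mul, bloch_apply]
      at e1 e2 e3 ⊢
    rw [hsdef]
    field_simp
    linear_combination -r₂ * e1 - r₁ * e2 + r₁ * r₂ * e3
  have hmem : s ∈ Set.Icc (0 : ℝ) 1 := ⟨ht₁.trans hs₁.le, hs₂.le.trans ht₂⟩
  refine ⟨s, ⟨(k * (r₁ * r₂ / (r₁ + r₂)), c), ⟨⟨by positivity, ?_⟩, hc⟩, hvs.symm⟩, hs₁, hs₂⟩
  exact hbound s hmem _ c hc hvs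

theorem IsUnit₂.exists_comb_of_nonneg (h1 : p.AxiomI) (h2 : p.AxiomII) (h3 : p.AxiomIII)
    (h4 : p.AxiomIV) {σ : S → ℝ} (hσ : p.IsUnit₂ σ) {a b : S} (ha : σ a = 1) (hb : σ b = 1)
    {s t : ℝ} (hs : 0 ≤ s) (ht : 0 ≤ t) :
    ∃ r : ℝ, 0 ≤ r ∧ ∃ x, σ x = 1 ∧ s • p.bloch σ a + t • p.bloch σ b = r • p.bloch σ x := by
  rcases (p.prob_nonneg a b).eq_or_lt with hab | hab
  · obtain ⟨a', ha', haa, e⟩ := hσ.exists_compl h1 h2 h3 ha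
    have hb' : b = a' := by
      have := congrFun e b
      rw [Pi.add_apply, ← hab, zero_add, hb] at this
      exact (h1.eq this).symm
    subst hb'
    have e' : p.bloch σ b = - p.bloch σ a := by
      funext z
      have := congrFun e z
      simp only [bloch_apply, Pi.neg_apply, Pi.add_apply] at this ⊢
      linarith
    rcases le_total t s with hts | hts
    · refine ⟨s - t, by linarith, a, ha, ?_⟩
      rw [e', smul_neg, ← sub_eq_add_neg, sub_smul]
    · refine ⟨t - s, by linarith, b, hb, ?_⟩
      rw [e', smul_neg, smul_neg, sub_smul, neg_sub, ← sub_eq_add_neg]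
  · rcases (add_nonneg hs ht).eq_or_lt with h0 | h0
    · have hs0 : s = 0 := by linarith
      have ht0 : t = 0 := by linarith
      exact ⟨0, le_rfl, a, ha, by simp [hs0, ht0]⟩
    · obtain ⟨r, hr, x, hx, e⟩ := hσ.exists_segment h1 h2 h3 h4 ha hb hab (t := t / (s + t))
        ⟨by positivity, by rw [div_le_one h0]; linarith⟩
      refine ⟨(s + t) * r, by positivity, x, hx, ?_⟩
      rw [mul_smul, ← e, smul_add, smul_smul, smul_smul, mul_sub, mul_one,
        mul_div_cancel₀ _ h0.ne', add_sub_cancel_right]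

/-- The multiples of the Bloch vectors of a qubit form a linear space. -/
theorem IsUnit₂.exists_blochSpace (h1 : p.AxiomI) (h2 : p.AxiomII) (h3 : p.AxiomIII)
    (h4 : p.AxiomIV) {σ : S → ℝ} (hσ : p.IsUnit₂ σ) :
    ∃ K : Submodule ℝ (S → ℝ), ∀ w, w ∈ K ↔
      ∃ r : ℝ, 0 ≤ r ∧ ∃ x, σ x = 1 ∧ w = r • p.bloch σ x := by
  refine ⟨{ carrier := {w | ∃ r : ℝ, 0 ≤ r ∧ ∃ x, σ x = 1 ∧ w = r • p.bloch σ x}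
            add_mem' := ?_, zero_mem' := ?_, smul_mem' := ?_ }, fun w => Iff.rfl⟩
  · rintro _ _ ⟨r, hr, x, hx, rfl⟩ ⟨s, hs, y, hy, rfl⟩
    exact hσ.exists_comb_of_nonneg h1 h2 h3 h4 hx hy hr hs
  · obtain ⟨c, c', hcc, rfl⟩ := hσ
    refine ⟨0, le_rfl, c, ?_, by simp⟩
    rw [Pi.add_apply, h1.self, h1.symm c' c, show p.prob c c' = 0 from hcc, add_zero]
  · rintro t _ ⟨r, hr, x, hx, rfl⟩
    rcases le_total 0 t with ht | ht
    · exact ⟨t * r, by positivity, x, hx, smul_smul _ _ _⟩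
    · obtain ⟨x', hx', e⟩ := hσ.exists_bloch_neg h1 h2 h3 hx
      refine ⟨-t * r, mul_nonneg (by linarith) hr, x', hx', ?_⟩
      rw [e, smul_smul, smul_neg, neg_mul, neg_smul, neg_neg]

/-- A functional that is maximal on the Bloch sphere at `c` is a multiple of the coordinate
along `c`. -/
theorem IsUnit₂.apply_bloch_of_max (h1 : p.AxiomI) (h2 : p.AxiomII) (h3 : p.AxiomIII)
    (h4 : p.AxiomIV) {σ : S → ℝ} (hσ : p.IsUnit₂ σ) {c : S} (hc : σ c = 1)
    (T : (S → ℝ) →ₗ[ℝ] ℝ) (hT : ∀ x, σ x = 1 → T (p.bloch σ x) ≤ T (p.bloch σ c))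
    {x : S} (hx : σ x = 1) :
    T (p.bloch σ x) = T (p.bloch σ c) * (2 * p.prob c x - 1) := by
  have habs : ∀ y, σ y = 1 → |T (p.bloch σ y)| ≤ T (p.bloch σ c) := by
    intro y hy
    obtain ⟨y', hy', e⟩ := hσ.exists_bloch_neg h1 h2 h3 hy
    have := hT y' hy'
    rw [e, map_neg] at this
    exact abs_le.2 ⟨by linarith, hT y hy⟩
  set m := T (p.bloch σ c) with hm
  set q := T (p.bloch σ x) with hq
  set κ := 2 * p.prob c x - 1 with hκ
  have hm0 : 0 ≤ m := (abs_nonneg _).trans (habs c hc)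
  have hqm := habs x hx
  rw [← hq] at hqm
  obtain ⟨K, hK⟩ := hσ.exists_blochSpace h1 h2 h3 h4
  have hmem : ∀ y, σ y = 1 → p.bloch σ y ∈ K :=
    fun y hy => (hK _).2 ⟨1, zero_le_one, y, hy, (one_smul _ _).symm⟩
  -- The vector of c plus t times that of x is r times a Bloch vector, with r² = 1 + 2tκ + t², and T
  -- is at most r m on it.
  have key : ∀ t : ℝ, (m + t * q) ≤ 0 ∨ (m + t * q) ^ 2 ≤ m ^ 2 * (1 + 2 * t * κ + t ^ 2) := by
    intro t
    obtain ⟨r, hr, y, hy, e⟩ := (hK _).1 (K.add_mem (hmem c hc) (K.smul_mem t (hmem x hx)))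
    have e1 := congrFun e c
    have e2 := congrFun e x
    have e3 := congrFun e y
    simp only [Pi.add_apply, Pi.smul_apply, smul_eq_mul, bloch_apply_of_mem _ hc,
      bloch_apply_of_mem _ hx, bloch_apply_of_mem _ hy, h1.self, h1.symm x c, h1.symm y c,
      h1.symm y x] at e1 e2 e3
    have hr2 : r ^ 2 = 1 + 2 * t * κ + t ^ 2 := by
      rw [hκ]
      linear_combination -r * e3 - e1 - t * e2
    have e4 := congrArg T e
    rw [map_add, map_smul, map_smul, smul_eq_mul, smul_eq_mul, ← hm, ← hq] at e4
    have h5 : m + t * q ≤ r * m := by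
      rw [e4]
      exact mul_le_mul_of_nonneg_left (hT y hy) hr
    rcases le_total (m + t * q) 0 with h | h
    · exact Or.inl h
    · right
      rw [← hr2]
      nlinarith [mul_nonneg hr hm0]
  rcases hm0.eq_or_lt with h0 | h0
  · rw [← h0] at hqm ⊢
    rw [zero_mul]
    exact abs_eq_zero.1 (le_antisymm hqm (abs_nonneg _))
  have hb : 0 ≤ m ^ 2 - q ^ 2 := by
    rw [← sq_abs q]
    nlinarith [abs_nonneg q]
  -- The squared inequality reads t · 2m(q - mκ) ≤ t²(m² - q²), so the linear coefficient vanishes.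
  -- The case m + tq ≤ 0 with |t| ≤ 1 is the extreme one |t| = 1, |q| = m, where tκ ≥ -1 is enough.
  have : 2 * m * (q - m * κ) = 0 := by
    refine eq_zero_of_forall_mul_le_sq_mul hb fun t ht => ?_
    rcases key t with h | h
    · have h6 : |t * q| ≤ m := by
        rw [abs_mul]
        nlinarith [abs_nonneg t, abs_nonneg q]
      have h7 : m + t * q = 0 := le_antisymm h (by linarith [(abs_le.1 h6).1])
      have h8 : |t| * |q| = m := by
        rw [← abs_mul, show t * q = -m by linarith, abs_neg, abs_of_pos h0]
      have h9 : |q| = m := by nlinarith [abs_nonneg t, abs_nonneg q]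
      have h10 : |t| = 1 := by
        rw [h9] at h8
        exact mul_right_cancel₀ h0.ne' (by rw [h8, one_mul])
      have h11 : t ^ 2 = 1 := by rw [← sq_abs, h10, one_pow]
      have hκ1 : -1 ≤ κ ∧ κ ≤ 1 := by
        constructor <;> rw [hκ] <;> linarith [p.prob_nonneg c x, p.prob_le_one c x]
      have h12 : t * q = -m := by linarith
      have h13 : -1 ≤ t * κ := by
        have : |t * κ| ≤ 1 := by
          rw [abs_mul, h10, one_mul]
          exact abs_le.2 hκ1
        linarith [(abs_le.1 this).1]
      nlinarith [sq_abs q]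
    · nlinarith
  have h5 := (mul_eq_zero.1 this).resolve_left (by positivity)
  linarith

/-- Bessel's identity in a qubit. -/
theorem IsUnit₂.exists_residual (h1 : p.AxiomI) (h2 : p.AxiomII) (h3 : p.AxiomIII)
    (h4 : p.AxiomIV) {σ : S → ℝ} (hσ : p.IsUnit₂ σ) {s : Finset S} (hs : ∀ i ∈ s, σ i = 1)
    (ho : (s : Set S).Pairwise fun i j => p.prob i j = 1 / 2) {z : S} (hz : σ z = 1) :
    ∃ r : ℝ, r ^ 2 = 1 - ∑ i ∈ s, (2 * p.prob i z - 1) ^ 2 ∧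
      ∃ x, σ x = 1 ∧ (r ≠ 0 → ∀ i ∈ s, p.prob i x = 1 / 2) := by
  classical
  obtain ⟨K, hK⟩ := hσ.exists_blochSpace h1 h2 h3 h4
  have hmem : ∀ y, σ y = 1 → p.bloch σ y ∈ K :=
    fun y hy => (hK _).2 ⟨1, zero_le_one, y, hy, (one_smul _ _).symm⟩
  -- The vector of z minus its components along s is r times the Bloch vector of x; evaluating it at
  -- z and at x computes r².
  obtain ⟨r, hr, x, hx, e⟩ := (hK _).1 (K.sub_mem (hmem z hz) (K.sum_mem (t := s)
    (f := fun i => (2 * p.prob i z - 1) • p.bloch σ i)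
    fun i hi => K.smul_mem _ (hmem i (hs i hi))))
  have ev : ∀ y, σ y = 1 → (2 * p.prob z y - 1) -
      ∑ i ∈ s, (2 * p.prob i z - 1) * (2 * p.prob i y - 1) = r * (2 * p.prob x y - 1) := by
    intro y hy
    have := congrFun e y
    simpa only [Pi.sub_apply, Finset.sum_apply, Pi.smul_apply, smul_eq_mul,
      bloch_apply_of_mem _ hy] using this
  have hi0 : ∀ i ∈ s, r * (2 * p.prob i x - 1) = 0 := by
    intro i hi
    rw [h1.symm i x, ← ev i (hs i hi), Finset.sum_eq_single_of_mem i hi, h1.self, h1.symm z i]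
    · ring
    · intro j hj hji
      rw [ho hj hi hji]
      ring
  have hrz : r * (2 * p.prob x z - 1) = 1 - ∑ i ∈ s, (2 * p.prob i z - 1) ^ 2 := by
    rw [← ev z hz, h1.self]
    simp only [sq]
    ring
  have hrx : 2 * p.prob z x - 1 - ∑ i ∈ s, (2 * p.prob i z - 1) * (2 * p.prob i x - 1) = r := by
    rw [ev x hx, h1.self]
    ring
  refine ⟨r, ?_, x, hx, fun hr0 i hi => ?_⟩
  · rw [← hrz, sq]
    nth_rewrite 2 [← hrx]
    rw [mul_sub, Finset.mul_sum, Finset.sum_eq_zero, sub_zero, h1.symm x z]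
    intro i hi
    rw [mul_left_comm, hi0 i hi, mul_zero]
  · have := (mul_eq_zero.1 (hi0 i hi)).resolve_left hr0
    linarith

/-- Squaring removes the absolute value in the purity, and 1/3 is the second moment of the uniform
distribution on [0, 1]. -/
theorem AxiomV.exists_measure (h5 : p.AxiomV) {σ : S → ℝ} (hσ : p.IsUnit₂ σ) :
    ∃ (_ : MeasurableSpace {z | σ z = 1}) (μ : Measure {z | σ z = 1}), IsProbabilityMeasure μ ∧
      ∀ x, σ x = 1 → Integrable (fun y : {z | σ z = 1} => (2 * p.prob x y - 1) ^ 2) μ ∧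
        ∫ y : {z | σ z = 1}, (2 * p.prob x y - 1) ^ 2 ∂μ = 1 / 3 := by
  obtain ⟨c, c', hcc, rfl⟩ := hσ
  obtain ⟨μ, hμ, hV⟩ := h5 _ ⟨c, c', hcc, rfl⟩
  let := p.borelOn {z | p.prob c z + p.prob c' z = 1}
  have hprob : IsProbabilityMeasure μ := hμ.1
  refine ⟨p.borelOn _, μ, hprob, fun x hx => ?_⟩
  have hmap := hV ⟨x, hx⟩
  have hae : AEMeasurable
      (fun y : {z | p.prob c z + p.prob c' z = 1} => p.purity x y) μ := by
    -- The push-forward along a map that is not a.e. measurable is 0 by convention, which has the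
    -- wrong total mass.
    by_contra hn
    rw [Measure.map_of_not_aemeasurable hn] at hmap
    have := congrArg (fun m : Measure ℝ => m Set.univ) hmap
    simp at this
  have hsq : (fun y : {z | p.prob c z + p.prob c' z = 1} => (2 * p.prob x y - 1) ^ 2) =
      fun y : {z | p.prob c z + p.prob c' z = 1} => p.purity x y ^ 2 := by
    funext y
    rw [purity, sq_abs]
  constructor
  · refine Integrable.of_bound (C := 1) ?_ (Filter.Eventually.of_forall fun y => ?_)
    · exact hsq ▸ (hae.pow_const 2).aestronglyMeasurable
    · rw [Real.norm_eq_abs, abs_of_nonneg (sq_nonneg _)]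
      nlinarith [p.prob_nonneg x y, p.prob_le_one x y]
  · have hi : ∫ t, t ^ 2 ∂(μ.map
        fun y : {z | p.prob c z + p.prob c' z = 1} => p.purity x y) = ∫ y, p.purity x y ^ 2 ∂μ :=
      integral_map hae (continuous_pow 2).aestronglyMeasurable
    refine (congrArg (fun f => ∫ y, f y ∂μ) hsq).trans (hi.symm.trans ?_)
    rw [hmap, integral_Icc_eq_integral_Ioc, ← intervalIntegral.integral_of_le zero_le_one,
      integral_pow]
    norm_num

/-- The Bloch ball of a qubit is three-dimensional. -/
theorem IsUnit₂.bloch_dimension (h1 : p.AxiomI) (h2 : p.AxiomII) (h3 : p.AxiomIII)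
    (h4 : p.AxiomIV) (h5 : p.AxiomV) {σ : S → ℝ} (hσ : p.IsUnit₂ σ) {s : Finset S}
    (hs : ∀ i ∈ s, σ i = 1) (ho : (s : Set S).Pairwise fun i j => p.prob i j = 1 / 2) :
    (s.card < 3 → ∃ x, σ x = 1 ∧ ∀ i ∈ s, p.prob i x = 1 / 2) ∧
      (s.card = 3 → ∀ z, σ z = 1 → ∑ i ∈ s, (2 * p.prob i z - 1) ^ 2 = 1) := by
  classical
  obtain ⟨m, μ, hμ, hint⟩ := h5.exists_measure hσ
  have hsum : ∀ t : Finset S, (∀ i ∈ t, σ i = 1) →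
      ∫ y : {z | σ z = 1}, ∑ i ∈ t, (2 * p.prob i y - 1) ^ 2 ∂μ = (t.card : ℝ) / 3 := by
    intro t ht
    rw [integral_finsetSum _ fun i hi => (hint i (ht i hi)).1,
      Finset.sum_congr rfl fun i hi => (hint i (ht i hi)).2]
    simp [div_eq_mul_inv]
  -- Bessel's inequality, integrated, reads `t.card` / 3 ≤ 1.
  have hle : ∀ t : Finset S, (∀ i ∈ t, σ i = 1) →
      (t : Set S).Pairwise (fun i j => p.prob i j = 1 / 2) → t.card ≤ 3 := by
    intro t ht hto
    have h : ∫ y : {z | σ z = 1}, ∑ i ∈ t, (2 * p.prob i y - 1) ^ 2 ∂μ ≤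
        ∫ _ : {z | σ z = 1}, (1 : ℝ) ∂μ := by
      refine integral_mono (integrable_finsetSum _ fun i hi => (hint i (ht i hi)).1)
        (integrable_const _) fun y => ?_
      obtain ⟨r, hr, -⟩ := hσ.exists_residual h1 h2 h3 h4 ht hto y.2
      simp only
      linarith [sq_nonneg r]
    rw [hsum t ht, integral_const, probReal_univ, smul_eq_mul, mul_one,
      div_le_one (by norm_num)] at h
    exact_mod_cast h
  have hext : ∀ z, σ z = 1 → ∑ i ∈ s, (2 * p.prob i z - 1) ^ 2 ≠ 1 →
      ∃ x, σ x = 1 ∧ ∀ i ∈ s, p.prob i x = 1 / 2 := by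
    intro z hz hne
    obtain ⟨r, hr, x, hx, h⟩ := hσ.exists_residual h1 h2 h3 h4 hs ho hz
    refine ⟨x, hx, h ?_⟩
    rintro rfl
    exact hne (by linarith)
  constructor
  · intro hcard
    -- If s could not be extended, the sum of squares would be identically 1, and its integral would
    -- force `s.card` = 3.
    by_contra hno
    have hall : ∀ y : {z | σ z = 1}, ∑ i ∈ s, (2 * p.prob i y - 1) ^ 2 = 1 := by
      intro y
      by_contra hne
      exact hno (hext y y.2 hne)
    have h := hsum s hs
    simp only [hall, integral_const, probReal_univ, smul_eq_mul, mul_one] at h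
    have h' : (s.card : ℝ) = 3 := by linarith
    have : s.card = 3 := by exact_mod_cast h'
    omega
  · intro hcard z hz
    -- A nonzero residual would provide a fourth orthogonal Bloch vector.
    by_contra hne
    obtain ⟨x, hx, hxs⟩ := hext z hz hne
    have hxn : x ∉ s := fun h => by
      have := hxs x h
      rw [h1.self] at this
      norm_num at this
    have := hle (insert x s) (by
        intro i hi
        rcases Finset.mem_insert.1 hi with rfl | hi
        exacts [hx, hs i hi]) (by
        rw [Finset.coe_insert]
        refine ho.insert fun i hi _ => ⟨(h1.symm x i).trans (hxs i hi), hxs i hi⟩)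
    rw [Finset.card_insert_of_notMem hxn] at this
    omega

end PTable

/-! ### Compressions and the spectral theorem -/

namespace PTable

variable {S : Type*} {p : PTable S}

/-- On the qubit of e and f the nonnegative function z ↦ z(y) attains its minimum 0 at e, so it is
proportional to the transition probability to f. -/
theorem prob_eq_mul_of_mem_qubit (h1 : p.AxiomI) (h2 : p.AxiomII) (h3 : p.AxiomIII)
    (h4 : p.AxiomIV) {e f z y : S} (hef : p.prob e f = 0) (hz : p.prob e z + p.prob f z = 1)
    (hy : p.prob e y = 0) : p.prob z y = p.prob f z * p.prob f y := by
  have hσ := IsUnit₂.of_orthogonal (p := p) hef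
  have he : (p.prob e + p.prob f) e = 1 := by
    rw [Pi.add_apply, h1.self, h1.symm f e, hef, add_zero]
  have hT : ∀ x, (-LinearMap.proj y : (S → ℝ) →ₗ[ℝ] ℝ) (p.bloch (p.prob e + p.prob f) x) =
      p.prob f y - 2 * p.prob x y := by
    intro x
    rw [LinearMap.neg_apply, LinearMap.proj_apply, bloch_apply, Pi.add_apply, hy]
    ring
  have h := hσ.apply_bloch_of_max h1 h2 h3 h4 he (-LinearMap.proj y) (fun x _ => by
    rw [hT, hT, hy]
    linarith [p.prob_nonneg x y]) hz
  rw [hT, hT, hy] at h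
  linear_combination -(1 / 2) * h - p.prob f y * hz

theorem prob_eq_zero_of_mem_qubit (h1 : p.AxiomI) (h2 : p.AxiomII) (h3 : p.AxiomIII)
    (h4 : p.AxiomIV) {e f z y : S} (hef : p.prob e f = 0) (hz : p.prob e z + p.prob f z = 1)
    (hy : p.prob e y = 0) (hy' : p.prob f y = 0) : p.prob z y = 0 := by
  rw [prob_eq_mul_of_mem_qubit h1 h2 h3 h4 hef hz hy, hy', mul_zero]

/-- The component of `z` orthogonal to `e`. -/
theorem exists_compression (h1 : p.AxiomI) (h2 : p.AxiomII) (h3 : p.AxiomIII)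
    (h4 : p.AxiomIV) {e z : S} (hez : e ≠ z) :
    ∃ f, p.prob e f = 0 ∧ p.prob e z + p.prob f z = 1 ∧
      ∀ g, p.prob g e = 0 → p.prob g z = 0 → p.prob g f = 0 := by
  obtain ⟨σ, hσ, he, hz, h0⟩ := h4.exists_unit h1 h2 h3 hez
  obtain ⟨f, -, hef, rfl⟩ := hσ.exists_compl h1 h2 h3 he
  refine ⟨f, hef, hz, fun g hge hgz => ?_⟩
  have := h0 g hge hgz
  rw [Pi.add_apply, h1.symm e g, hge, zero_add, h1.symm f g] at this
  exact this

/-- Restricted to the orthogonal complement of a finite orthogonal set, every element is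
proportional to an element of the complement. -/
theorem exists_compression_finset (h1 : p.AxiomI) (h2 : p.AxiomII) (h3 : p.AxiomIII)
    (h4 : p.AxiomIV) {C : Finset S} (hC : (C : Set S).Pairwise p.Orthogonal) (z : S) :
    ∃ (ρ : ℝ) (q : S), (ρ ≠ 0 → ∀ c ∈ C, p.prob c q = 0) ∧
      ∀ y, (∀ c ∈ C, p.prob c y = 0) → p.prob z y = ρ * p.prob q y := by
  classical
  induction C using Finset.induction_on with
  | empty => exact ⟨1, z, by simp, by simp⟩
  | insert c C hc ih =>
    obtain ⟨ρ, q, hq, h⟩ := ih (hC.mono (by simp))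
    by_cases hcq : c = q
    · subst hcq
      refine ⟨0, c, fun h => absurd rfl h, fun y hy => ?_⟩
      rw [h y fun d hd => hy d (Finset.mem_insert_of_mem hd), hy c (Finset.mem_insert_self _ _)]
      ring
    obtain ⟨f, hcf, hcq', hf⟩ := exists_compression h1 h2 h3 h4 hcq
    refine ⟨ρ * p.prob f q, f, fun hρ d hd => ?_, fun y hy => ?_⟩
    · rcases Finset.mem_insert.1 hd with rfl | hd'
      · exact hcf
      · refine hf d ?_ (hq (left_ne_zero_of_mul hρ) d hd')
        exact hC (Finset.mem_coe.2 hd) (Finset.mem_coe.2 (Finset.mem_insert_self _ _))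
          fun h => hc (h ▸ hd')
    · rw [h y fun d hd => hy d (Finset.mem_insert_of_mem hd),
        prob_eq_mul_of_mem_qubit h1 h2 h3 h4 hcf hcq' (hy c (Finset.mem_insert_self _ _)), mul_assoc]

/-- The span of the elements orthogonal to `C`. -/
def complSpan (p : PTable S) (C : Finset S) : Submodule ℝ (S → ℝ) :=
  Submodule.span ℝ (p.prob '' {x | ∀ c ∈ C, p.prob c x = 0})

theorem complSpan_induction {C : Finset S} {P : (S → ℝ) → Prop}
    (mem : ∀ x, (∀ c ∈ C, p.prob c x = 0) → P (p.prob x)) (zero : P 0)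
    (add : ∀ v w, P v → P w → P (v + w)) (smul : ∀ (a : ℝ) v, P v → P (a • v)) {v : S → ℝ}
    (hv : v ∈ p.complSpan C) : P v := by
  refine Submodule.span_induction (p := fun v _ => P v) ?_ zero
    (fun v w _ _ => add v w) (fun a v _ => smul a v) hv
  rintro _ ⟨x, hx, rfl⟩
  exact mem x hx

/-- By symmetry a combination of the functions `p.prob x` is also the same combination of the
evaluations at x. Maximality of v over points thus becomes maximality of a linear functional, as
`apply_bloch_of_max` requires. -/
theorem exists_functional (h1 : p.AxiomI) {C : Finset S} {v : S → ℝ}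
    (hv : v ∈ p.complSpan C) : ∃ T : (S → ℝ) →ₗ[ℝ] ℝ, ∀ y, T (p.prob y) = v y := by
  refine complSpan_induction
    (P := fun v => ∃ T : (S → ℝ) →ₗ[ℝ] ℝ, ∀ y, T (p.prob y) = v y) ?_ ⟨0, fun y => rfl⟩ ?_ ?_ hv
  · exact fun x _ => ⟨LinearMap.proj x, fun y => h1.symm y x⟩
  · rintro v w ⟨T, hT⟩ ⟨U, hU⟩
    exact ⟨T + U, fun y => by rw [LinearMap.add_apply, hT, hU, Pi.add_apply]⟩
  · rintro a v ⟨T, hT⟩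
    exact ⟨a • T, fun y => by rw [LinearMap.smul_apply, hT, Pi.smul_apply]⟩

theorem continuous_of_mem_complSpan (h1 : p.AxiomI) {C : Finset S} {v : S → ℝ}
    (hv : v ∈ p.complSpan C) : @Continuous S ℝ p.topology _ v := by
  let := p.pseudoMetric
  refine complSpan_induction (fun x _ => continuous_prob h1 x) continuous_const ?_ ?_ hv
  · exact fun v w hv hw => hv.add hw
  · exact fun a v hv => hv.const_smul a

theorem apply_eq_mul_of_mem_complSpan (h1 : p.AxiomI) {C : Finset S} {v : S → ℝ}
    (hv : v ∈ p.complSpan C) {z q : S} {ρ : ℝ}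
    (h : ∀ y, (∀ c ∈ C, p.prob c y = 0) → p.prob z y = ρ * p.prob q y) : v z = ρ * v q := by
  refine complSpan_induction (P := fun v => v z = ρ * v q) ?_ (by simp) ?_ ?_ hv
  · intro x hx
    rw [h1.symm x z, h1.symm x q, h x hx]
  · intro v w hv hw
    rw [Pi.add_apply, Pi.add_apply, hv, hw, mul_add]
  · intro a v hv
    rw [Pi.smul_apply, Pi.smul_apply, hv, smul_eq_mul, smul_eq_mul]
    ring

/-- The function v₀ is the compression of v to the complement of c: each generator x is replaced by
its component g orthogonal to c, weighted by g(x). -/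
theorem exists_deflation (h1 : p.AxiomI) (h2 : p.AxiomII) (h3 : p.AxiomIII)
    (h4 : p.AxiomIV) [DecidableEq S] {C : Finset S} {c : S} (hc : ∀ d ∈ C, p.prob d c = 0)
    {v : S → ℝ} (hv : v ∈ p.complSpan C) :
    ∃ v₀ ∈ p.complSpan (insert c C), v₀ c = 0 ∧ ∀ f q, p.prob c f = 0 →
      p.prob c q + p.prob f q = 1 → v₀ q = p.prob f q * v f := by
  refine complSpan_induction (P := fun v => ∃ v₀ ∈ p.complSpan (insert c C), v₀ c = 0 ∧
    ∀ f q, p.prob c f = 0 → p.prob c q + p.prob f q = 1 → v₀ q = p.prob f q * v f)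
    ?_ ⟨0, Submodule.zero_mem _, rfl, by simp⟩ ?_ ?_ hv
  · intro x hx
    by_cases hcx : c = x
    · subst hcx
      exact ⟨0, Submodule.zero_mem _, rfl, fun f q hf _ => by simp [hf]⟩
    obtain ⟨g, hcg, hx', hg⟩ := exists_compression h1 h2 h3 h4 hcx
    refine ⟨p.prob g x • p.prob g, Submodule.smul_mem _ _ (Submodule.subset_span
      (Set.mem_image_of_mem _ fun d hd => ?_)), ?_, fun f q hf hq => ?_⟩
    · rcases Finset.mem_insert.1 hd with rfl | hd
      exacts [hcg, hg d (hc d hd) (hx d hd)]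
    · rw [Pi.smul_apply, h1.symm g c, hcg, smul_zero]
    · rw [Pi.smul_apply, smul_eq_mul, h1.symm g q,
        prob_eq_mul_of_mem_qubit h1 h2 h3 h4 hf hq hcg,
        prob_eq_mul_of_mem_qubit h1 h2 h3 h4 hcg hx' hf, h1.symm f g]
      ring
  · rintro v w ⟨v₀, hv₀, hvc, hv⟩ ⟨w₀, hw₀, hwc, hw⟩
    refine ⟨v₀ + w₀, Submodule.add_mem _ hv₀ hw₀, by simp [hvc, hwc], fun f q hf hq => ?_⟩
    rw [Pi.add_apply, hv f q hf hq, hw f q hf hq, Pi.add_apply, mul_add]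
  · rintro a v ⟨v₀, hv₀, hvc, hv⟩
    refine ⟨a • v₀, Submodule.smul_mem _ _ hv₀, by simp [hvc], fun f q hf hq => ?_⟩
    rw [Pi.smul_apply, hv f q hf hq, Pi.smul_apply, smul_eq_mul, smul_eq_mul]
    ring

/-- The spectral theorem in the orthogonal complement of a finite orthogonal set. -/
theorem exists_spectral_decomposition_compl (h1 : p.AxiomI) (h2 : p.AxiomII) (h3 : p.AxiomIII)
    (h4 : p.AxiomIV) {F : Finset S} (hF : p.IsFiniteFrame F) (k : ℕ) (C : Finset S)
    (hC : (C : Set S).Pairwise p.Orthogonal) (hcard : F.card ≤ C.card + k) (v : S → ℝ)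
    (hv : v ∈ p.complSpan C) :
    ∃ G : Finset S, (G : Set S).Pairwise p.Orthogonal ∧ (∀ g ∈ G, ∀ c ∈ C, p.prob c g = 0) ∧
      ∃ l : S → ℝ, v = ∑ g ∈ G, l g • p.prob g := by
  classical
  let := p.pseudoMetric
  have : CompactSpace S := h2
  induction k generalizing C v with
  | zero =>
    obtain ⟨G, hG, hCG⟩ := exists_isFiniteFrame_superset h1 h2 h3 hC
    have hGC : C = G := Finset.eq_of_subset_of_card_le hCG (by
      rw [hG.card_eq h1 hF]
      omega)
    subst hGC
    refine ⟨∅, by simp, by simp, 0, ?_⟩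
    have hempty : {x | ∀ c ∈ C, p.prob c x = 0} = ∅ := by
      refine Set.eq_empty_iff_forall_notMem.2 fun x hx => ?_
      have := hG.2 x
      rw [Finset.sum_eq_zero fun c hc => hx c hc] at this
      exact zero_ne_one this
    rw [complSpan, hempty, Set.image_empty, Submodule.span_empty, Submodule.mem_bot] at hv
    simpa using hv
  | succ k ih =>
    rcases Set.eq_empty_or_nonempty {x | ∀ c ∈ C, p.prob c x = 0} with hempty | hne
    · refine ⟨∅, by simp, by simp, 0, ?_⟩
      rw [complSpan, hempty, Set.image_empty, Submodule.span_empty, Submodule.mem_bot] at hv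
      simpa using hv
    have hclosed : IsClosed {x | ∀ c ∈ C, p.prob c x = 0} := by
      simp only [Set.ofPred_forall]
      exact isClosed_biInter fun c _ => isClosed_eq (continuous_prob h1 c) continuous_const
    -- A maximum point of v on the compact complement of C serves as an eigenvector.
    obtain ⟨c, hc, hmax⟩ := hclosed.isCompact.exists_isMaxOn hne
      (continuous_of_mem_complSpan h1 hv).continuousOn
    have hmax' : ∀ x, (∀ d ∈ C, p.prob d x = 0) → v x ≤ v c := fun x hx => hmax hx
    obtain ⟨v₀, hv₀, hv₀c, hv₀q⟩ := exists_deflation h1 h2 h3 h4 hc hv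
    obtain ⟨T, hT⟩ := exists_functional h1 hv
    -- On the qubit of c and q the maximum is at c, so v is diagonal in the frame c, f: v(q) = v(c)
    -- c(q) + v(f) f(q).
    have hrestr : ∀ q, (∀ d ∈ C, p.prob d q = 0) → v q = v c * p.prob c q + v₀ q := by
      intro q hq
      by_cases hcq : c = q
      · subst hcq
        rw [h1.self, hv₀c, mul_one, add_zero]
      obtain ⟨f, hcf, hcq', hf⟩ := exists_compression h1 h2 h3 h4 hcq
      rw [hv₀q f q hcf hcq']
      have hσ := IsUnit₂.of_orthogonal (p := p) hcf
      have hc1 : (p.prob c + p.prob f) c = 1 := by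
        rw [Pi.add_apply, h1.self, h1.symm f c, hcf, add_zero]
      have hTb : ∀ x, T (p.bloch (p.prob c + p.prob f) x) = 2 * v x - (v c + v f) := by
        intro x
        rw [bloch, map_sub, map_smul, map_add, hT, hT, hT, smul_eq_mul]
      have key := hσ.apply_bloch_of_max h1 h2 h3 h4 hc1 T (fun x hx => by
        rw [hTb, hTb]
        have := hmax' x fun d hd => by
          rw [h1.symm d x]
          exact prob_eq_zero_of_mem_qubit h1 h2 h3 h4 hcf hx ((h1.symm c d).trans (hc d hd))
            ((h1.symm f d).trans (hf d (hc d hd) (hq d hd)))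
        linarith) hcq'
      rw [hTb, hTb] at key
      linear_combination (1 / 2) * key - v f * hcq'
    -- On the functions in `complSpan`, evaluation at z is ρ times evaluation at a point q, which
    -- lies in the complement if ρ ≠ 0; so the identity extends to all of S.
    have hall : v = v c • p.prob c + v₀ := by
      funext z
      obtain ⟨ρ, q, hq, h⟩ := exists_compression_finset h1 h2 h3 h4 hC z
      have e2 := apply_eq_mul_of_mem_complSpan h1 hv₀ (z := z) (q := q) (ρ := ρ)
        fun y hy => h y fun d hd => hy d (Finset.mem_insert_of_mem hd)
      rw [Pi.add_apply, Pi.smul_apply, smul_eq_mul, apply_eq_mul_of_mem_complSpan h1 hv h, e2,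
        h1.symm c z, h c hc]
      by_cases hρ : ρ = 0
      · simp [hρ]
      · rw [hrestr q (hq hρ), h1.symm c q]
        ring
    have hcC : c ∉ C := fun h => h1.ne_of_orthogonal (hc c h) rfl
    obtain ⟨G, hGo, hGC, l, hl⟩ := ih (insert c C) (pairwise_orthogonal_insert h1 hC hc)
      (by rw [Finset.card_insert_of_notMem hcC]; omega) v₀ hv₀
    have hcG : c ∉ G := fun h =>
      h1.ne_of_orthogonal (hGC c h c (Finset.mem_insert_self _ _)) rfl
    refine ⟨insert c G, pairwise_orthogonal_insert h1 hGo fun g hg => ?_, fun g hg d hd => ?_,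
      Function.update l c (v c), ?_⟩
    · exact (h1.symm g c).trans (hGC g hg c (Finset.mem_insert_self _ _))
    · rcases Finset.mem_insert.1 hg with rfl | hg
      exacts [hc d hd, hGC g hg d (Finset.mem_insert_of_mem hd)]
    · rw [Finset.sum_insert hcG, Function.update_self]
      refine hall.trans (congrArg _ (hl.trans (Finset.sum_congr rfl fun g hg => ?_)))
      rw [Function.update_of_ne (fun h => hcG (h ▸ hg) : g ≠ c)]

/-- The spectral theorem. -/
theorem exists_spectral_decomposition (h1 : p.AxiomI) (h2 : p.AxiomII) (h3 : p.AxiomIII)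
    (h4 : p.AxiomIV) (a : S →₀ ℝ) :
    ∃ G : Finset S, (G : Set S).Pairwise p.Orthogonal ∧
      ∃ l : S → ℝ, Finsupp.linearCombination ℝ p.prob a = ∑ g ∈ G, l g • p.prob g := by
  obtain ⟨F, hF, -⟩ := exists_isFiniteFrame_superset (C := ∅) h1 h2 h3 (by simp)
  obtain ⟨G, hG, -, l, hl⟩ := exists_spectral_decomposition_compl h1 h2 h3 h4 hF F.card ∅
    (by simp) (by simp) (Finsupp.linearCombination ℝ p.prob a) (by
      rw [complSpan, Finsupp.linearCombination_apply, Finsupp.sum]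
      exact Submodule.sum_mem _ fun x _ => Submodule.smul_mem _ _
        (Submodule.subset_span (Set.mem_image_of_mem _
          fun c hc => absurd hc (Finset.notMem_empty c))))
  exact ⟨G, hG, l, hl⟩

/-! ### Positivity of the table and its feature map -/

/-- The bilinear extension of a `p`-table to formal combinations. -/
noncomputable def form (p : PTable S) (a b : S →₀ ℝ) : ℝ :=
  Finsupp.linearCombination ℝ (fun x => Finsupp.linearCombination ℝ (p.prob x) b) a

theorem form_comm (h1 : p.AxiomI) (a b : S →₀ ℝ) : p.form a b = p.form b a := by
  simp only [form, Finsupp.linearCombination_apply, Finsupp.sum, smul_eq_mul, Finset.mul_sum]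
  rw [Finset.sum_comm]
  refine Finset.sum_congr rfl fun x _ => Finset.sum_congr rfl fun y _ => ?_
  rw [h1.symm y x]
  ring

/-- In a spectral decomposition of a, orthogonality of the eigenvectors turns `p.form a a` into the
sum of the squared eigenvalues. -/
theorem form_self_nonneg (h1 : p.AxiomI) (h2 : p.AxiomII) (h3 : p.AxiomIII)
    (h4 : p.AxiomIV) (a : S →₀ ℝ) : 0 ≤ p.form a a := by
  classical
  obtain ⟨G, hG, l, hl⟩ := exists_spectral_decomposition h1 h2 h3 h4 a
  have hev : ∀ x, Finsupp.linearCombination ℝ (p.prob x) a = ∑ g ∈ G, l g * p.prob g x := by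
    intro x
    have := congrFun hl x
    rw [Finset.sum_apply] at this
    simp only [Pi.smul_apply, smul_eq_mul] at this
    rw [← this]
    simp only [Finsupp.linearCombination_apply, Finsupp.sum, Finset.sum_apply, Pi.smul_apply]
    exact Finset.sum_congr rfl fun y _ => by rw [h1.symm y x]
  have : p.form a a = ∑ g ∈ G, l g ^ 2 := by
    have h : p.form a a = ∑ g ∈ G, l g * Finsupp.linearCombination ℝ (p.prob g) a := by
      simp only [form, hev]
      simp only [Finsupp.linearCombination_apply, Finsupp.sum, smul_eq_mul, Finset.mul_sum]
      rw [Finset.sum_comm]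
      have hev' : ∀ g ∈ G, ∑ y ∈ a.support, a y * (l g * p.prob g y) =
        l g * ∑ y ∈ a.support, a y * p.prob g y := fun g _ => by
          rw [Finset.mul_sum]
          exact Finset.sum_congr rfl fun y _ => by ring
      rw [Finset.sum_congr rfl hev']
      refine Finset.sum_congr rfl fun g _ => ?_
      rw [← Finset.mul_sum]
      have := hev g
      rw [Finsupp.linearCombination_apply] at this
      simp only [Finsupp.sum, smul_eq_mul] at this
      rw [this, Finset.mul_sum]
    rw [h]
    refine Finset.sum_congr rfl fun g hg => ?_
    rw [hev, Finset.sum_eq_single_of_mem g hg, h1.self]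
    · ring
    · intro d hd hdg
      rw [show p.prob d g = 0 from hG hd hg hdg, mul_zero]
  rw [this]
  exact Finset.sum_nonneg fun g _ => sq_nonneg _

end PTable

/-- The inner product space is the space of formal combinations, with the null vectors of the form
divided out. -/
theorem PTable.exists_featureMap.{u} {S : Type u} {p : PTable S} (h1 : p.AxiomI)
    (h2 : p.AxiomII) (h3 : p.AxiomIII) (h4 : p.AxiomIV) :
    ∃ (V : Type u) (_ : NormedAddCommGroup V) (_ : InnerProductSpace ℝ V) (ι : S → V),
      ∀ x y, inner ℝ (ι x) (ι y) = p.prob x y := by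
  let core : PreInnerProductSpace.Core ℝ (S →₀ ℝ) :=
    { inner := p.form
      conj_inner_symm := fun a b => form_comm h1 b a
      re_inner_nonneg := fun a => form_self_nonneg h1 h2 h3 h4 a
      add_left := fun a b c => by simp [form]
      smul_left := fun a b c => by simp [form] }
  let : SeminormedAddCommGroup (S →₀ ℝ) := InnerProductSpace.Core.toSeminormedAddCommGroup (𝕜 := ℝ)
  let : InnerProductSpace ℝ (S →₀ ℝ) := .ofCore core
  refine ⟨SeparationQuotient (S →₀ ℝ), inferInstance, inferInstance,
    fun x => SeparationQuotient.mk (Finsupp.single x 1), fun x y => ?_⟩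
  rw [SeparationQuotient.inner_mk_mk]
  change p.form _ _ = _
  simp [form]

/-! ### Maps that are self-adjoint up to signs -/

section

variable {E : Type*} [NormedAddCommGroup E] [InnerProductSpace ℝ E]

theorem exists_forall_inner_ne_zero {ι : Type*} [Finite ι] {a : ι → E} (ha : ∀ i, a i ≠ 0) :
    ∃ w, ∀ i, inner ℝ w (a i) ≠ 0 := by
  obtain ⟨w, -, hw⟩ := Module.Dual.exists_forall_mem_ne_zero_of_forall_exists
    (⊤ : Submodule ℝ E) (f := fun i => innerₗ E (a i)) fun i => ⟨a i, trivial, by simpa using ha i⟩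
  exact ⟨w, fun i => by simpa [real_inner_comm] using hw i⟩

/-- A map that is self-adjoint up to signs is linear up to signs. -/
theorem exists_linearMap_eq_or_eq_neg [FiniteDimensional ℝ E] (I : E → E)
    (hI : ∀ v w, inner ℝ (I v) w ^ 2 = inner ℝ v (I w) ^ 2) (h0 : ∀ v ≠ 0, I v ≠ 0) :
    ∃ J : E →ₗ[ℝ] E, ∀ v, I v = J v ∨ I v = -J v := by
  rcases subsingleton_or_nontrivial E with hE | hE
  · exact ⟨0, fun v => Or.inl (Subsingleton.elim _ _)⟩
  set b := stdOrthonormalBasis ℝ E with hb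
  have : Nonempty (Fin (Module.finrank ℝ E)) := ⟨⟨0, Module.finrank_pos⟩⟩
  obtain ⟨o⟩ := this
  -- The left side is the square of ⟨w, I (b o + b i)⟩. If this vector were neither ±(I (b o) + I (b
  -- i)) nor ±(I (b o) - I (b i)), a generic w would make four factors nonzero whose product
  -- vanishes.
  have hsign : ∀ i, ∃ s : ℝ, s ^ 2 = 1 ∧ ∀ w,
      (inner ℝ (I w) (b o) + inner ℝ (I w) (b i)) ^ 2 =
        (inner ℝ w (I (b o)) + s * inner ℝ w (I (b i))) ^ 2 := by
    intro i
    by_contra hno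
    push Not at hno
    obtain ⟨w₁, hw₁⟩ := hno 1 (by norm_num)
    obtain ⟨w₂, hw₂⟩ := hno (-1) (by norm_num)
    have hsq : ∀ w, (inner ℝ (I w) (b o) + inner ℝ (I w) (b i)) ^ 2 =
        inner ℝ w (I (b o + b i)) ^ 2 := fun w => by rw [← inner_add_right, hI]
    rw [hsq, one_mul, ← inner_add_right] at hw₁
    rw [hsq, neg_one_mul, ← sub_eq_add_neg, ← inner_sub_right] at hw₂
    set a := I (b o + b i)
    set j := I (b o)
    set k := I (b i)
    obtain ⟨w, hw⟩ := exists_forall_inner_ne_zero (ι := Fin 4)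
      (a := ![a - (j + k), a + (j + k), a - (j - k), a + (j - k)]) (by
        intro m
        fin_cases m
        · exact fun h => hw₁ (by rw [sub_eq_zero.1 (show a - (j + k) = 0 from h)])
        · exact fun h => hw₁ (by
            rw [eq_neg_of_add_eq_zero_left (show a + (j + k) = 0 from h), inner_neg_right, neg_sq])
        · exact fun h => hw₂ (by rw [sub_eq_zero.1 (show a - (j - k) = 0 from h)])
        · exact fun h => hw₂ (by
            rw [eq_neg_of_add_eq_zero_left (show a + (j - k) = 0 from h), inner_neg_right, neg_sq]))
    have e₁ : inner ℝ w (a - (j + k)) ≠ 0 := hw 0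
    have e₂ : inner ℝ w (a + (j + k)) ≠ 0 := hw 1
    have e₃ : inner ℝ w (a - (j - k)) ≠ 0 := hw 2
    have e₄ : inner ℝ w (a + (j - k)) ≠ 0 := hw 3
    have h1 := hsq w
    have h2 : inner ℝ (I w) (b o) ^ 2 = inner ℝ w j ^ 2 := hI w (b o)
    have h3 : inner ℝ (I w) (b i) ^ 2 = inner ℝ w k ^ 2 := hI w (b i)
    refine mul_ne_zero (mul_ne_zero e₁ e₂) (mul_ne_zero e₃ e₄) ?_
    simp only [inner_add_right, inner_sub_right]
    have h4 : (inner ℝ (I w) (b o) * inner ℝ (I w) (b i)) ^ 2 = (inner ℝ w j * inner ℝ w k) ^ 2 := by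
      rw [mul_pow, mul_pow, h2, h3]
    have h5 : 2 * (inner ℝ (I w) (b o) * inner ℝ (I w) (b i)) =
        inner ℝ w a ^ 2 - inner ℝ w j ^ 2 - inner ℝ w k ^ 2 := by
      linear_combination h1 - h2 - h3
    have h6 : (inner ℝ w a ^ 2 - inner ℝ w j ^ 2 - inner ℝ w k ^ 2) ^ 2 =
        4 * (inner ℝ w j * inner ℝ w k) ^ 2 := by
      rw [← h5]
      linear_combination 4 * h4
    linear_combination h6
  choose s hs1 hs using hsign
  -- The factor `s o` normalizes the overall sign so that J (b o) = I (b o).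
  let J : E →ₗ[ℝ] E := ∑ i, (innerₗ E (b i)).smulRight (s o • s i • I (b i))
  have hJ : ∀ u, J u = ∑ i, inner ℝ (b i) u • s o • s i • I (b i) := by
    intro u
    simp [J]
  -- For such w the sign ε relating ⟨I w, b o⟩ to ⟨w, I (b o)⟩ governs all the other coordinates of
  -- I w.
  have hgen : ∀ w u, inner ℝ w (I (b o)) ≠ 0 → inner ℝ w (I u) ^ 2 = inner ℝ w (J u) ^ 2 := by
    intro w u hw
    set ε := inner ℝ (I w) (b o) / inner ℝ w (I (b o)) with hε
    have hεo : inner ℝ (I w) (b o) = ε * inner ℝ w (I (b o)) := (div_mul_cancel₀ _ hw).symm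
    have hε2 : ε ^ 2 = 1 := by
      rw [hε, div_pow, hI, div_self (pow_ne_zero 2 hw)]
    have hi : ∀ i, inner ℝ (I w) (b i) = ε * (s i * inner ℝ w (I (b i))) := by
      intro i
      have e1 := hs i w
      have e2 := hI w (b i)
      have e3 := hI w (b o)
      have e4 : inner ℝ w (I (b o)) * (ε * inner ℝ (I w) (b i) - s i * inner ℝ w (I (b i))) = 0 := by
        rw [hεo] at e1 e3
        linear_combination (1 / 2) * e1 - (1 / 2) * e3 - (1 / 2) * e2 +
          (1 / 2) * inner ℝ w (I (b i)) ^ 2 * hs1 i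
      have e5 := (mul_eq_zero.1 e4).resolve_left hw
      linear_combination ε * e5 - inner ℝ (I w) (b i) * hε2
    have hsum : inner ℝ (I w) u = s o * ε * inner ℝ w (J u) := by
      rw [hJ, inner_sum, Finset.mul_sum, ← b.sum_inner_mul_inner (I w) u]
      refine Finset.sum_congr rfl fun i _ => ?_
      rw [hi i, real_inner_smul_right, real_inner_smul_right, real_inner_smul_right]
      linear_combination -ε * s i * inner ℝ w (I (b i)) * inner ℝ (b i) u * hs1 o
    rw [← hI, hsum, mul_pow, mul_pow, hε2, hs1, one_mul, one_mul]
  refine ⟨J, fun u => ?_⟩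
  by_contra hne
  rw [not_or] at hne
  obtain ⟨w, hw⟩ := exists_forall_inner_ne_zero (ι := Fin 3)
    (a := ![I (b o), I u - J u, I u + J u]) (by
      intro m
      fin_cases m
      · exact h0 _ (b.orthonormal.ne_zero o)
      · exact sub_ne_zero.2 hne.1
      · exact fun h => hne.2 (eq_neg_of_add_eq_zero_left h))
  have e₁ : inner ℝ w (I u - J u) ≠ 0 := hw 1
  have e₂ : inner ℝ w (I u + J u) ≠ 0 := hw 2
  refine mul_ne_zero e₁ e₂ ?_
  rw [inner_sub_right, inner_add_right]
  linear_combination hgen w u (hw 0)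

end

theorem eq_of_inner_sub_self_eq_zero {V : Type*} [NormedAddCommGroup V] [InnerProductSpace ℝ V]
    {v w : V} (h : inner ℝ v v - 2 * inner ℝ v w + inner ℝ w w = 0) : v = w := by
  rw [← sub_eq_zero, ← inner_self_eq_zero (𝕜 := ℝ), inner_sub_left, inner_sub_right,
    inner_sub_right, real_inner_comm v w]
  linarith

/-! ### Affine charts and the planes of the qubits through e -/

namespace PTable

variable {S : Type*} {p : PTable S}

/-- The five axioms. -/
structure Axioms (p : PTable S) : Prop where
  one : p.AxiomI
  two : p.AxiomII
  three : p.AxiomIII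
  four : p.AxiomIV
  five : p.AxiomV

theorem Axioms.prob_eq_mul (hp : p.Axioms) {e f z y : S} (hef : p.prob e f = 0)
    (hz : p.prob e z + p.prob f z = 1) (hy : p.prob e y = 0) :
    p.prob z y = p.prob f z * p.prob f y :=
  prob_eq_mul_of_mem_qubit hp.one hp.two hp.three hp.four hef hz hy

theorem Axioms.exists_orthogonal_of_card_lt (hp : p.Axioms) {F C : Finset S}
    (hF : p.IsFiniteFrame F) (hC : (C : Set S).Pairwise p.Orthogonal) (h : C.card < F.card) :
    ∃ u, ∀ c ∈ C, p.prob c u = 0 := by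
  obtain ⟨G, hG, hCG⟩ := exists_isFiniteFrame_superset hp.one hp.two hp.three hC
  obtain ⟨u, huG, huC⟩ := Finset.exists_mem_notMem_of_card_lt_card
    (h.trans_eq (hF.card_eq hp.one hG))
  exact ⟨u, fun c hc => hG.1 (hCG hc) huG fun h => huC (h ▸ hc)⟩

/-- The conditional state on a qubit of an element that is not orthogonal to it. -/
theorem Axioms.exists_conditional (hp : p.Axioms) {e g x : S} (heg : p.prob e g = 0)
    (hx : p.prob e x ≠ 0) :
    ∃ (ρ : ℝ) (q : S), ρ ≠ 0 ∧ p.prob e q + p.prob g q = 1 ∧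
      ∀ y, p.prob e y + p.prob g y = 1 → p.prob x y = ρ * p.prob q y := by
  have hσ := IsUnit₂.of_orthogonal (p := p) heg
  obtain ⟨R, hR, hsum, -⟩ := hσ.exists_rest hp.one hp.two hp.three
  obtain ⟨ρ, q, hq, h⟩ := exists_compression_finset hp.one hp.two hp.three hp.four hR x
  have h0 : ∀ y, p.prob e y + p.prob g y = 1 → ∀ r ∈ R, p.prob r y = 0 := by
    intro y hy
    have e1 := hsum y
    rw [Pi.add_apply, hy, add_eq_left,
      Finset.sum_eq_zero_iff_of_nonneg fun r _ => p.prob_nonneg r y] at e1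
    exact e1
  have he : p.prob e e + p.prob g e = 1 := by rw [hp.one.self, hp.one.symm g e, heg, add_zero]
  have hρ : ρ ≠ 0 := by
    rintro rfl
    exact hx (by rw [hp.one.symm e x, h e (h0 e he), zero_mul])
  refine ⟨ρ, q, hρ, ?_, fun y hy => h y (h0 y hy)⟩
  have e1 := hsum q
  rwa [Finset.sum_eq_zero fun r hr => hq hρ r hr, add_zero] at e1

/-- The data of an affine chart around `e`: a feature map `ι`, and the component `f x` of `x`
orthogonal to `e`. -/
structure Chart (p : PTable S) (V : Type*) [NormedAddCommGroup V] [InnerProductSpace ℝ V] where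
  ι : S → V
  inner_ι : ∀ x y, inner ℝ (ι x) (ι y) = p.prob x y
  e : S
  f : S → S
  prob_e_f : ∀ x, e ≠ x → p.prob e (f x) = 0
  prob_add : ∀ x, e ≠ x → p.prob e x + p.prob (f x) x = 1

theorem Axioms.exists_chart (hp : p.Axioms) {V : Type*} [NormedAddCommGroup V]
    [InnerProductSpace ℝ V] {ι : S → V} (hι : ∀ x y, inner ℝ (ι x) (ι y) = p.prob x y) (e : S) :
    ∃ A : p.Chart V, A.e = e := by
  classical
  have h : ∀ x, ∃ f, e ≠ x → p.prob e f = 0 ∧ p.prob e x + p.prob f x = 1 := by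
    intro x
    by_cases hx : e = x
    · exact ⟨e, fun h => absurd hx h⟩
    · obtain ⟨f, h, h', -⟩ := exists_compression hp.one hp.two hp.three hp.four hx
      exact ⟨f, fun _ => ⟨h, h'⟩⟩
  choose f hf using h
  exact ⟨⟨ι, hι, e, f, fun x hx => (hf x hx).1, fun x hx => (hf x hx).2⟩, rfl⟩

namespace Chart

variable {V : Type*} [NormedAddCommGroup V] [InnerProductSpace ℝ V] (A : p.Chart V)

/-- The affine coordinate vector. -/
noncomputable def η (x : S) : V :=
  (√2 * p.prob A.e x)⁻¹ • (A.ι x - p.prob A.e x • A.ι A.e - (1 - p.prob A.e x) • A.ι (A.f x))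

theorem η_of_prob_eq_zero {x : S} (hx : p.prob A.e x = 0) : A.η x = 0 := by
  simp [η, hx]

theorem prob_eq (hp : p.Axioms) (x : S) {y : S} (hy : p.prob A.e y = 0) :
    p.prob x y = (1 - p.prob A.e x) * p.prob (A.f x) y := by
  by_cases hx : A.e = x
  · subst hx
    rw [hy, hp.one.self, sub_self, zero_mul]
  · rw [hp.prob_eq_mul (A.prob_e_f x hx) (A.prob_add x hx) hy, ← A.prob_add x hx,
      add_sub_cancel_left]

/-- In the model x = [1 : ζ] one has e(x) = 1 / (1 + |ζ|²) and f x = [0 : ζ]. Subtracting the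
diagonal blocks from the projector of x leaves its off-diagonal part, and the factor √2 e(x) in `η`
makes the inner product of two coordinates equal to Re⟨ζ, ω⟩. -/
theorem inner_η (hp : p.Axioms) {x y : S} (hx : p.prob A.e x ≠ 0) (hy : p.prob A.e y ≠ 0) :
    2 * p.prob A.e x * p.prob A.e y * inner ℝ (A.η x) (A.η y) =
      p.prob x y - p.prob A.e x * p.prob A.e y -
        (1 - p.prob A.e x) * (1 - p.prob A.e y) * p.prob (A.f x) (A.f y) := by
  have hs : (√2 : ℝ) ^ 2 = 2 := Real.sq_sqrt (by norm_num)
  have hs0 : (√2 : ℝ) ≠ 0 := by positivity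
  have e0 : 2 * p.prob A.e x * p.prob A.e y * inner ℝ (A.η x) (A.η y) =
      inner ℝ (A.ι x - p.prob A.e x • A.ι A.e - (1 - p.prob A.e x) • A.ι (A.f x))
        (A.ι y - p.prob A.e y • A.ι A.e - (1 - p.prob A.e y) • A.ι (A.f y)) := by
    rw [η, η, real_inner_smul_left, real_inner_smul_right]
    field_simp
    rw [hs]
  rw [e0]
  simp only [inner_sub_left, inner_sub_right, real_inner_smul_left, real_inner_smul_right,
    A.inner_ι, hp.one.self, hp.one.symm x A.e]
  -- The value of f at e is arbitrary, but its coefficient 1 - e(e) is 0.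
  by_cases hxe : A.e = x
  · subst hxe
    rw [hp.one.self]
    ring
  by_cases hye : A.e = y
  · subst hye
    rw [hp.one.self, hp.one.symm x A.e, hp.one.symm (A.f x) A.e, A.prob_e_f x hxe]
    ring
  rw [A.prob_eq hp x (A.prob_e_f y hye), hp.one.symm (A.f x) y, A.prob_eq hp y (A.prob_e_f x hxe),
    hp.one.symm (A.f y) (A.f x), A.prob_e_f y hye, hp.one.symm (A.f x) A.e, A.prob_e_f x hxe]
  ring

theorem inner_η_self (hp : p.Axioms) {x : S} (hx : p.prob A.e x ≠ 0) :
    inner ℝ (A.η x) (A.η x) = (1 - p.prob A.e x) / p.prob A.e x := by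
  have h := A.inner_η hp hx hx
  rw [hp.one.self, hp.one.self] at h
  rw [eq_div_iff hx]
  refine mul_left_cancel₀ (mul_ne_zero two_ne_zero hx) ?_
  linear_combination h

theorem η_e (hp : p.Axioms) : A.η A.e = 0 := by
  have h := A.inner_η_self hp (x := A.e) (by rw [hp.one.self]; exact one_ne_zero)
  rw [hp.one.self, sub_self, zero_div] at h
  exact inner_self_eq_zero.1 h

theorem f_eq (hp : p.Axioms) {g y : S} (heg : p.prob A.e g = 0)
    (hy : p.prob A.e y + p.prob g y = 1) (hne : A.e ≠ y) : A.f y = g := by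
  have h := A.prob_eq hp y heg
  have h' : p.prob y g = 1 - p.prob A.e y := by rw [hp.one.symm y g]; linarith
  have h0 : 1 - p.prob A.e y ≠ 0 := fun h => hne (hp.one.eq (by linarith))
  exact hp.one.eq (mul_left_cancel₀ h0 (by rw [← h, h', mul_one]))

/-- Two points of the equator of the qubit of `e` and `g`, at a right angle. -/
structure IsTriple (g y₁ y₂ : S) : Prop where
  e_g : p.prob A.e g = 0
  e_y₁ : p.prob A.e y₁ = 1 / 2
  e_y₂ : p.prob A.e y₂ = 1 / 2
  g_y₁ : p.prob g y₁ = 1 / 2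
  g_y₂ : p.prob g y₂ = 1 / 2
  y₁_y₂ : p.prob y₁ y₂ = 1 / 2

/-- Since the Bloch ball is three-dimensional, e extends to three orthogonal axes e, y₁, y₂. -/
theorem exists_isTriple (hp : p.Axioms) {g : S} (hg : p.prob A.e g = 0) :
    ∃ y₁ y₂, A.IsTriple g y₁ y₂ := by
  classical
  have hσ := IsUnit₂.of_orthogonal (p := p) hg
  have he : (p.prob A.e + p.prob g) A.e = 1 := by
    rw [Pi.add_apply, hp.one.self, hp.one.symm g A.e, hg, add_zero]
  obtain ⟨y₁, h₁, h₁'⟩ := (hσ.bloch_dimension hp.one hp.two hp.three hp.four hp.five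
    (s := {A.e}) (by simpa using he) (by simp)).1 (by simp)
  have h₁e : p.prob A.e y₁ = 1 / 2 := h₁' A.e (by simp)
  have hne : A.e ≠ y₁ := by
    rintro h
    rw [← h, hp.one.self] at h₁e
    norm_num at h₁e
  obtain ⟨y₂, h₂, h₂'⟩ := (hσ.bloch_dimension hp.one hp.two hp.three hp.four hp.five
    (s := {A.e, y₁}) (by
      intro i hi
      rcases Finset.mem_insert.1 hi with rfl | hi
      · exact he
      · rw [Finset.mem_singleton.1 hi, h₁]) (by
      rw [Finset.coe_pair, Set.pairwise_pair]
      exact fun _ => ⟨h₁e, (hp.one.symm y₁ A.e).trans h₁e⟩)).1 (by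
      rw [Finset.card_pair hne]
      norm_num)
  have h₂e : p.prob A.e y₂ = 1 / 2 := h₂' A.e (by simp)
  rw [Pi.add_apply] at h₁ h₂
  exact ⟨y₁, y₂, hg, h₁e, h₂e, by linarith, by linarith, h₂' y₁ (by simp)⟩

namespace IsTriple

variable {A} {g y₁ y₂ : S}

theorem swap (hp : p.Axioms) (h : A.IsTriple g y₁ y₂) : A.IsTriple g y₂ y₁ :=
  ⟨h.e_g, h.e_y₂, h.e_y₁, h.g_y₂, h.g_y₁, (hp.one.symm y₂ y₁).trans h.y₁_y₂⟩

theorem ne₁ (hp : p.Axioms) (h : A.IsTriple g y₁ y₂) : A.e ≠ y₁ := by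
  intro h'
  have := h.e_y₁
  rw [← h', hp.one.self] at this
  norm_num at this

theorem prob_ne_zero (h : A.IsTriple g y₁ y₂) : p.prob A.e y₁ ≠ 0 := by
  rw [h.e_y₁]
  norm_num

theorem f_y₁ (hp : p.Axioms) (h : A.IsTriple g y₁ y₂) : A.f y₁ = g :=
  A.f_eq hp h.e_g (by rw [h.e_y₁, h.g_y₁]; norm_num) (h.ne₁ hp)

theorem inner_self (hp : p.Axioms) (h : A.IsTriple g y₁ y₂) :
    inner ℝ (A.η y₁) (A.η y₁) = 1 := by
  rw [A.inner_η_self hp h.prob_ne_zero, h.e_y₁]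
  norm_num

theorem inner_η (hp : p.Axioms) (h : A.IsTriple g y₁ y₂) {x : S} (hx : p.prob A.e x ≠ 0) :
    p.prob A.e x * inner ℝ (A.η x) (A.η y₁) =
      p.prob x y₁ - 1 / 2 * p.prob A.e x - 1 / 2 * p.prob x g := by
  have e1 := A.inner_η hp hx h.prob_ne_zero
  rw [h.f_y₁ hp, h.e_y₁] at e1
  rw [A.prob_eq hp x h.e_g]
  linear_combination e1

theorem inner_eq_zero (hp : p.Axioms) (h : A.IsTriple g y₁ y₂) :
    inner ℝ (A.η y₁) (A.η y₂) = 0 := by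
  have e1 := (h.swap hp).inner_η hp h.prob_ne_zero
  rw [h.e_y₁, h.y₁_y₂, hp.one.symm y₁ g, h.g_y₁] at e1
  linarith

theorem sq_add_sq (hp : p.Axioms) (h : A.IsTriple g y₁ y₂) {q : S}
    (hq : p.prob A.e q + p.prob g q = 1) :
    (2 * p.prob A.e q - 1) ^ 2 + (2 * p.prob y₁ q - 1) ^ 2 + (2 * p.prob y₂ q - 1) ^ 2 = 1 := by
  classical
  have h12 : y₁ ≠ y₂ := by
    rintro h'
    have := h.y₁_y₂
    rw [← h', hp.one.self] at this
    norm_num at this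
  have hn1 := h.ne₁ hp
  have hn2 := (h.swap hp).ne₁ hp
  have hcard : ({A.e, y₁, y₂} : Finset S).card = 3 := Finset.card_eq_three.2
    ⟨_, _, _, hn1, hn2, h12, rfl⟩
  have key := ((IsUnit₂.of_orthogonal (p := p) h.e_g).bloch_dimension hp.one hp.two hp.three
    hp.four hp.five (s := {A.e, y₁, y₂}) (by
      intro i hi
      simp only [Finset.mem_insert, Finset.mem_singleton] at hi
      rcases hi with rfl | rfl | rfl
      · rw [Pi.add_apply, hp.one.self, hp.one.symm g, h.e_g, add_zero]
      · rw [Pi.add_apply, h.e_y₁, h.g_y₁]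
        norm_num
      · rw [Pi.add_apply, h.e_y₂, h.g_y₂]
        norm_num) (by
      intro i hi j hj hij
      simp only [Finset.coe_insert, Finset.coe_singleton, Set.mem_insert_iff,
        Set.mem_singleton_iff] at hi hj
      rcases hi with rfl | rfl | rfl <;> rcases hj with rfl | rfl | rfl
      · exact absurd rfl hij
      · exact h.e_y₁
      · exact h.e_y₂
      · exact (hp.one.symm _ _).trans h.e_y₁
      · exact absurd rfl hij
      · exact h.y₁_y₂
      · exact (hp.one.symm _ _).trans h.e_y₂
      · exact (hp.one.symm _ _).trans h.y₁_y₂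
      · exact absurd rfl hij)).2 hcard q hq
  rw [Finset.sum_insert (by simp [hn1, hn2]), Finset.sum_pair h12] at key
  linarith

/-- The projection to the plane of `g` scales squared lengths by the transition probability. -/
theorem conformal (hp : p.Axioms) (h : A.IsTriple g y₁ y₂) {x : S} (hx : p.prob A.e x ≠ 0) :
    inner ℝ (A.η x) (A.η y₁) ^ 2 + inner ℝ (A.η x) (A.η y₂) ^ 2 =
      inner ℝ (A.η x) (A.η x) * p.prob (A.f x) g := by
  -- On the qubit of e and g the state x is ρ times a pure state q. The claim is that the Bloch
  -- vector of q has length one, in affine coordinates.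
  obtain ⟨ρ, q, hρ, hq, hcond⟩ := hp.exists_conditional h.e_g hx
  have key := h.sq_add_sq hp hq
  have hxe : p.prob A.e x = ρ * p.prob A.e q := by
    rw [hp.one.symm A.e x, hcond A.e (by rw [hp.one.self, hp.one.symm g, h.e_g, add_zero]),
      hp.one.symm q]
  have hxg : p.prob x g = ρ * (1 - p.prob A.e q) := by
    rw [hcond g (by rw [hp.one.self, h.e_g, zero_add]), hp.one.symm q, ← hq, add_sub_cancel_left]
  have e1 := h.inner_η hp hx
  have e2 := (h.swap hp).inner_η hp hx
  rw [hcond y₁ (by rw [h.e_y₁, h.g_y₁]; norm_num), hxg, hxe, hp.one.symm q y₁] at e1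
  rw [hcond y₂ (by rw [h.e_y₂, h.g_y₂]; norm_num), hxg, hxe, hp.one.symm q y₂] at e2
  have e1' : p.prob A.e q * inner ℝ (A.η x) (A.η y₁) = p.prob y₁ q - 1 / 2 :=
    mul_left_cancel₀ hρ (by linear_combination e1)
  have e2' : p.prob A.e q * inner ℝ (A.η x) (A.η y₂) = p.prob y₂ q - 1 / 2 :=
    mul_left_cancel₀ hρ (by linear_combination e2)
  have ha : p.prob A.e q ≠ 0 := by
    intro h0
    rw [h0, mul_zero] at hxe
    exact hx hxe
  have e3 := A.prob_eq hp x h.e_g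
  rw [A.inner_η_self hp hx, div_mul_eq_mul_div, ← e3, hxg, hxe, mul_div_mul_left _ _ hρ,
    eq_div_iff ha]
  refine mul_left_cancel₀ ha ?_
  linear_combination (1 / 4) * key +
    (p.prob A.e q * inner ℝ (A.η x) (A.η y₁) + p.prob y₁ q - 1 / 2) * e1' +
    (p.prob A.e q * inner ℝ (A.η x) (A.η y₂) + p.prob y₂ q - 1 / 2) * e2'

/-- Inverse stereographic projection: the qubit without g is mapped onto the whole plane. -/
theorem exists_η_eq (hp : p.Axioms) (h : A.IsTriple g y₁ y₂) (a b : ℝ) :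
    ∃ x, p.prob A.e x ≠ 0 ∧ p.prob A.e x + p.prob g x = 1 ∧
      A.η x = a • A.η y₁ + b • A.η y₂ := by
  obtain ⟨K, hK⟩ := (IsUnit₂.of_orthogonal (p := p) h.e_g).exists_blochSpace
    hp.one hp.two hp.three hp.four
  have he : (p.prob A.e + p.prob g) A.e = 1 := by
    rw [Pi.add_apply, hp.one.self, hp.one.symm g, h.e_g, add_zero]
  have hy₁ : (p.prob A.e + p.prob g) y₁ = 1 := by
    rw [Pi.add_apply, h.e_y₁, h.g_y₁]
    norm_num
  have hy₂ : (p.prob A.e + p.prob g) y₂ = 1 := by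
    rw [Pi.add_apply, h.e_y₂, h.g_y₂]
    norm_num
  have hmem : ∀ y, (p.prob A.e + p.prob g) y = 1 → p.bloch (p.prob A.e + p.prob g) y ∈ K :=
    fun y hy => (hK _).2 ⟨1, zero_le_one, y, hy, (one_smul _ _).symm⟩
  -- The value of e(x) in the model; (2q - 1, 2qa, 2qb) is then a unit vector, the Bloch vector of
  -- x.
  set q : ℝ := (1 + a ^ 2 + b ^ 2)⁻¹ with hq
  have hD : 0 < 1 + a ^ 2 + b ^ 2 := by positivity
  have hq0 : 0 < q := inv_pos.2 hD
  have hqm : q * (1 + a ^ 2 + b ^ 2) = 1 := inv_mul_cancel₀ hD.ne'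
  obtain ⟨r, hr, x, hx, e⟩ := (hK _).1 (K.add_mem (K.smul_mem (2 * q - 1) (hmem _ he))
    (K.add_mem (K.smul_mem (2 * q * a) (hmem _ hy₁)) (K.smul_mem (2 * q * b) (hmem _ hy₂))))
  have ee := congrFun e A.e
  have e1 := congrFun e y₁
  have e2 := congrFun e y₂
  have ex := congrFun e x
  simp only [Pi.add_apply (_ • _), Pi.smul_apply, smul_eq_mul,
    bloch_apply_of_mem _ he, bloch_apply_of_mem _ hy₁, bloch_apply_of_mem _ hy₂,
    bloch_apply_of_mem _ hx, hp.one.self, h.e_y₁, h.e_y₂, h.y₁_y₂, hp.one.symm _ A.e,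
    hp.one.symm y₂ y₁, hp.one.symm x] at ee e1 e2 ex
  have hr2 : r ^ 2 = 1 := by
    linear_combination -r * ex - (2 * q - 1) * ee - (2 * q * a) * e1 - (2 * q * b) * e2 +
      4 * q * hqm
  have hr1 : r = 1 := by nlinarith
  subst hr1
  have hxe : p.prob A.e x = q := by linarith
  have hx0 : p.prob A.e x ≠ 0 := by rw [hxe]; exact hq0.ne'
  have hxq : p.prob A.e x + p.prob g x = 1 := hx
  refine ⟨x, hx0, hxq, ?_⟩
  have hxg : p.prob x g = 1 - q := by rw [hp.one.symm x g, ← hxe]; linarith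
  have i1 := h.inner_η hp hx0
  have i2 := (h.swap hp).inner_η hp hx0
  rw [hxe, hxg, hp.one.symm x] at i1 i2
  have i1' : inner ℝ (A.η x) (A.η y₁) = a := mul_left_cancel₀ hq0.ne' (by linarith)
  have i2' : inner ℝ (A.η x) (A.η y₂) = b := mul_left_cancel₀ hq0.ne' (by linarith)
  have i3 : inner ℝ (A.η x) (A.η x) = a ^ 2 + b ^ 2 := by
    rw [A.inner_η_self hp hx0, hxe, div_eq_iff hq0.ne']
    linarith
  refine eq_of_inner_sub_self_eq_zero ?_
  simp only [inner_add_left, inner_add_right, real_inner_smul_left, real_inner_smul_right, i1', i2',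
    i3, h.inner_self hp, (h.swap hp).inner_self hp, h.inner_eq_zero hp,
    (h.swap hp).inner_eq_zero hp]
  ring

end IsTriple

/-- Rotation by a right angle in the plane of a point. -/
theorem exists_rotation (hp : p.Axioms) {y : S} (hy : p.prob A.e y ≠ 0) :
    ∃ y', p.prob A.e y' ≠ 0 ∧ inner ℝ (A.η y') (A.η y') = inner ℝ (A.η y) (A.η y) ∧
      ∀ x, p.prob A.e x ≠ 0 →
        inner ℝ (A.η x) (A.η y) ^ 2 + inner ℝ (A.η x) (A.η y') ^ 2 =
          inner ℝ (A.η x) (A.η x) * inner ℝ (A.η y) (A.η y) * p.prob (A.f x) (A.f y) := by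
  by_cases hye : A.e = y
  · subst hye
    exact ⟨A.e, hy, rfl, fun x _ => by simp [A.η_e hp]⟩
  obtain ⟨y₁, y₂, h⟩ := A.exists_isTriple hp (A.prob_e_f y hye)
  set a := inner ℝ (A.η y) (A.η y₁) with ha
  set b := inner ℝ (A.η y) (A.η y₂) with hb
  have hab : a ^ 2 + b ^ 2 = inner ℝ (A.η y) (A.η y) := by
    rw [ha, hb, h.conformal hp hy, hp.one.self, mul_one]
  have hyab : A.η y = a • A.η y₁ + b • A.η y₂ := by
    refine eq_of_inner_sub_self_eq_zero ?_
    simp only [inner_add_left, inner_add_right, real_inner_smul_left, real_inner_smul_right,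
      ← ha, ← hb, h.inner_self hp, (h.swap hp).inner_self hp, h.inner_eq_zero hp,
      (h.swap hp).inner_eq_zero hp]
    linear_combination -hab
  -- The coordinates (-b, a) are those of y turned by a right angle.
  obtain ⟨y', hy', -, hη⟩ := h.exists_η_eq hp (-b) a
  refine ⟨y', hy', ?_, fun x hx => ?_⟩
  · rw [← hab, hη]
    simp only [inner_add_left, inner_add_right, real_inner_smul_left, real_inner_smul_right,
      h.inner_self hp, (h.swap hp).inner_self hp, h.inner_eq_zero hp,
      (h.swap hp).inner_eq_zero hp]
    ring
  · rw [mul_right_comm, ← h.conformal hp hx, ← hab, hη]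
    nth_rewrite 1 [hyab]
    simp only [inner_add_right, real_inner_smul_right]
    ring

end Chart

end PTable

/-! ### Linearity of the range of the chart -/

namespace PTable

variable {S : Type*} {p : PTable S}

/-- In the complement of the rest of a frame, there is an element orthogonal to two given ones. -/
theorem Axioms.exists_orthogonal_pair (hp : p.Axioms) {F C : Finset S} (hF : p.IsFiniteFrame F)
    (hC : (C : Set S).Pairwise p.Orthogonal) (h : C.card + 2 < F.card) {x y : S} (hxy : x ≠ y)
    (hx : ∀ c ∈ C, p.prob c x = 0) (hy : ∀ c ∈ C, p.prob c y = 0) :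
    ∃ u, (∀ c ∈ C, p.prob c u = 0) ∧ p.prob u x = 0 ∧ p.prob u y = 0 := by
  classical
  obtain ⟨σ, ⟨d, d', hdd, rfl⟩, hσx, hσy, h0⟩ :=
    hp.four.exists_unit hp.one hp.two hp.three hxy
  have hd : ∀ c ∈ C, p.prob c d = 0 ∧ p.prob c d' = 0 := by
    intro c hc
    have := h0 c (hx c hc) (hy c hc)
    rw [Pi.add_apply] at this
    rw [hp.one.symm c d, hp.one.symm c d']
    constructor <;> linarith [p.prob_nonneg d c, p.prob_nonneg d' c]
  have hC' : ((insert d (insert d' C) : Finset S) : Set S).Pairwise p.Orthogonal := by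
    refine pairwise_orthogonal_insert hp.one (pairwise_orthogonal_insert hp.one hC fun c hc =>
      (hd c hc).2) fun c hc => ?_
    rcases Finset.mem_insert.1 hc with rfl | hc
    exacts [(hp.one.symm _ _).trans hdd, (hd c hc).1]
  obtain ⟨u, hu⟩ := hp.exists_orthogonal_of_card_lt hF hC' (lt_of_le_of_lt
    ((Finset.card_insert_le _ _).trans (Nat.succ_le_succ (Finset.card_insert_le _ _))) h)
  have hdu : p.prob d u = 0 := hu d (by simp)
  have hdu' : p.prob d' u = 0 := hu d' (by simp)
  refine ⟨u, fun c hc => hu c (by simp [hc]), ?_, ?_⟩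
  · rw [hp.one.symm u]
    exact prob_eq_zero_of_mem_qubit hp.one hp.two hp.three hp.four hdd hσx hdu hdu'
  · rw [hp.one.symm u]
    exact prob_eq_zero_of_mem_qubit hp.one hp.two hp.three hp.four hdd hσy hdu hdu'

namespace Chart

variable {V : Type*} [NormedAddCommGroup V] [InnerProductSpace ℝ V] (A : p.Chart V)

/-- If `u` is orthogonal to the complement of `x` in the qubit of `e` and `a`, then `u` restricts
to a multiple of `x` on this qubit. -/
theorem exists_restrict (hp : p.Axioms) {a x x' u : S} (ha : p.prob A.e a = 0)
    (hx : p.prob A.e x + p.prob a x = 1) (hxx : p.prob x + p.prob x' = p.prob A.e + p.prob a)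
    (hu : p.prob A.e u ≠ 0) (hux : p.prob u x' = 0) :
    ∃ ρ, p.prob A.e u = ρ * p.prob A.e x ∧ p.prob u a = ρ * (1 - p.prob A.e x) ∧
      p.prob u x = ρ := by
  have hv : ∀ z, p.prob x z + p.prob x' z = p.prob A.e z + p.prob a z := fun z => congrFun hxx z
  obtain ⟨ρ, q, hρ, hq, h⟩ := hp.exists_conditional ha hu
  have hxx0 : p.prob x x' = 0 := by
    have := hv x
    rw [hx, hp.one.self, add_eq_left, hp.one.symm] at this
    exact this
  have hx' : p.prob A.e x' + p.prob a x' = 1 := by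
    rw [← hv, hxx0, hp.one.self, zero_add]
  have hqx : p.prob q x' = 0 := by
    have := h x' hx'
    rw [hux] at this
    exact (mul_eq_zero.1 this.symm).resolve_left hρ
  have hqeq : x = q := by
    have := hv q
    rw [hq, hp.one.symm x', hqx, add_zero] at this
    exact hp.one.eq this
  subst hqeq
  refine ⟨ρ, ?_, ?_, ?_⟩
  · rw [hp.one.symm A.e u, h A.e (by rw [hp.one.self, hp.one.symm a, ha, add_zero]), hp.one.symm x]
  · rw [h a (by rw [hp.one.self, ha, zero_add]), hp.one.symm x a, ← hx, add_sub_cancel_left]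
  · rw [h x hx, hp.one.self, mul_one]

/-- In the model x = [1 : ζ : 0] and y = [1 : 0 : ω], and u = [1 : ζ : ω] is characterized by
orthogonality to the complements x', y' of x, y in their qubits with e, and to the rest of a frame
through e, f x, f y. -/
theorem exists_η_eq_add (hp : p.Axioms) {x y : S} (hx : p.prob A.e x ≠ 0)
    (hy : p.prob A.e y ≠ 0) (hxe : A.e ≠ x) (hye : A.e ≠ y) (hxy : p.prob (A.f x) (A.f y) = 0) :
    ∃ u, p.prob A.e u ≠ 0 ∧ A.η u = A.η x + A.η y := by
  classical
  have hea := A.prob_e_f x hxe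
  have heb := A.prob_e_f y hye
  have hxa := A.prob_add x hxe
  have hyb := A.prob_add y hye
  set a := A.f x with ha
  set b := A.f y with hb
  have hab : a ≠ b := hp.one.ne_of_orthogonal hxy
  have hae : A.e ≠ a := hp.one.ne_of_orthogonal hea
  have hbe : A.e ≠ b := hp.one.ne_of_orthogonal heb
  obtain ⟨F, hF, hsub⟩ := exists_isFiniteFrame_superset hp.one hp.two hp.three
    (pairwise_orthogonal_insert hp.one (pairwise_orthogonal_pair hp.one hxy) (x := A.e) (by
      intro c hc
      rcases Finset.mem_insert.1 hc with rfl | hc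
      · exact (hp.one.symm _ _).trans hea
      · rw [Finset.mem_singleton.1 hc]
        exact (hp.one.symm _ _).trans heb))
  set C := F \ {A.e, a, b} with hC
  have hcard3 : ({A.e, a, b} : Finset S).card = 3 :=
    Finset.card_eq_three.2 ⟨_, _, _, hae, hbe, hab, rfl⟩
  have hcard : C.card + 3 = F.card := by
    rw [← hcard3, hC, Finset.card_sdiff_add_card_eq_card hsub]
  have hCF : ∀ c ∈ C, ∀ d ∈ ({A.e, a, b} : Finset S), p.prob d c = 0 := by
    intro c hc d hd
    obtain ⟨h1, h2⟩ := Finset.mem_sdiff.1 hc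
    exact hF.1 (hsub hd) h1 fun h => h2 (h ▸ hd)
  have hCo : (C : Set S).Pairwise p.Orthogonal :=
    hF.1.mono (by exact_mod_cast Finset.sdiff_subset)
  obtain ⟨x', hx', -, hxx⟩ := (IsUnit₂.of_orthogonal (p := p) hea).exists_compl
    hp.one hp.two hp.three hxa
  obtain ⟨y', hy', -, hyy⟩ := (IsUnit₂.of_orthogonal (p := p) heb).exists_compl
    hp.one hp.two hp.three hyb
  rw [Pi.add_apply] at hx' hy'
  have hax' : p.prob a x' = p.prob A.e x := by
    have := congrFun hxx A.e
    simp only [Pi.add_apply, hp.one.self, hp.one.symm _ A.e, hea] at this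
    linarith
  have hby' : p.prob b y' = p.prob A.e y := by
    have := congrFun hyy A.e
    simp only [Pi.add_apply, hp.one.self, hp.one.symm _ A.e, heb] at this
    linarith
  have hne : x' ≠ y' := by
    rintro rfl
    rw [hp.one.symm, hp.prob_eq_mul heb hy' hea, hp.one.symm b a, hxy, mul_zero] at hax'
    exact hx hax'.symm
  have hCx : ∀ c ∈ C, p.prob c x' = 0 := fun c hc => by
    rw [hp.one.symm]
    exact prob_eq_zero_of_mem_qubit hp.one hp.two hp.three hp.four hea hx'
      (hCF c hc _ (by simp)) (hCF c hc _ (by simp))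
  have hCy : ∀ c ∈ C, p.prob c y' = 0 := fun c hc => by
    rw [hp.one.symm]
    exact prob_eq_zero_of_mem_qubit hp.one hp.two hp.three hp.four heb hy'
      (hCF c hc _ (by simp)) (hCF c hc _ (by simp))
  obtain ⟨u, huC, hux, huy⟩ := hp.exists_orthogonal_pair hF hCo (by omega) hne hCx hCy
  have hsum : p.prob A.e u + (p.prob a u + p.prob b u) = 1 := by
    rw [← hF.2 u, ← Finset.sum_sdiff hsub, ← hC, Finset.sum_eq_zero huC, zero_add,
      Finset.sum_insert (by simp [hae, hbe]), Finset.sum_pair hab]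
  -- If u were orthogonal to e, it would be orthogonal to a and b too, hence to a whole frame.
  have hu : p.prob A.e u ≠ 0 := by
    intro h0
    have e1 := hp.prob_eq_mul hea hx' h0
    have e2 := hp.prob_eq_mul heb hy' h0
    rw [hp.one.symm x', hux, hax'] at e1
    rw [hp.one.symm y', huy, hby'] at e2
    rw [h0, (mul_eq_zero.1 e1.symm).resolve_left hx, (mul_eq_zero.1 e2.symm).resolve_left hy] at hsum
    norm_num at hsum
  obtain ⟨ρ, e1, e2, e3⟩ := A.exists_restrict hp hea hxa hxx hu hux
  obtain ⟨τ, e4, e5, e6⟩ := A.exists_restrict hp heb hyb hyy hu huy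
  -- The component of η u along η z is η z itself. With the Pythagorean identity `k4`, the
  -- difference η u - η x - η y has norm 0.
  have key : ∀ {z : S} {ρ : ℝ}, p.prob A.e z ≠ 0 → A.e ≠ z →
      p.prob A.e u = ρ * p.prob A.e z → p.prob u (A.f z) = ρ * (1 - p.prob A.e z) →
      p.prob u z = ρ → inner ℝ (A.η u) (A.η z) = inner ℝ (A.η z) (A.η z) := by
    intro z ρ hz hze h1 h2 h3
    have h4 := A.inner_η hp hu hz
    rw [mul_right_comm (1 - _), ← A.prob_eq hp u (A.prob_e_f z hze), h2, h3] at h4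
    rw [A.inner_η_self hp hz, eq_div_iff hz]
    refine mul_left_cancel₀ hu ?_
    rw [h1] at h4 ⊢
    linear_combination (1 / 2) * h4
  have k1 := key hx hxe e1 e2 e3
  have k2 := key hy hye e4 e5 e6
  have k3 : inner ℝ (A.η x) (A.η y) = 0 := by
    obtain ⟨z, -, -, hz⟩ := A.exists_rotation hp hy
    have := hz x hx
    rw [← ha, ← hb, hxy, mul_zero] at this
    nlinarith [sq_nonneg (inner ℝ (A.η x) (A.η y)), sq_nonneg (inner ℝ (A.η x) (A.η z))]
  have k4 : inner ℝ (A.η u) (A.η u) = inner ℝ (A.η x) (A.η x) + inner ℝ (A.η y) (A.η y) := by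
    rw [A.inner_η_self hp hu, A.inner_η_self hp hx, A.inner_η_self hp hy]
    rw [hp.one.symm u] at e2 e5
    rw [show 1 - p.prob A.e u = p.prob a u + p.prob b u by linarith, add_div]
    congr 1
    · rw [e2, e1, mul_div_mul_left]
      rintro rfl
      exact hu (by rw [e1, zero_mul])
    · rw [e5, e4, mul_div_mul_left]
      rintro rfl
      exact hu (by rw [e4, zero_mul])
  refine ⟨u, hu, eq_of_inner_sub_self_eq_zero ?_⟩
  simp only [inner_add_left, inner_add_right, k1, k2, k3, k4, real_inner_comm (A.η x) (A.η y)]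
  ring

/-- The range of the affine chart is a finite-dimensional space. -/
theorem exists_range_eq (hp : p.Axioms) {n : ℕ} {x : Fin n → S}
    (ho : ∀ i j, i ≠ j → p.prob (x i) (x j) = 0) (he : ∀ i, p.prob A.e (x i) = 0)
    (hsum : ∀ z, p.prob A.e z + ∑ i, p.prob (x i) z = 1) :
    ∃ U : Submodule ℝ V, FiniteDimensional ℝ U ∧
      ∀ v, v ∈ U ↔ ∃ u, p.prob A.e u ≠ 0 ∧ A.η u = v := by
  classical
  choose y₁ y₂ hT using fun i => A.exists_isTriple hp (he i)
  let b₁ : Fin n → V := fun i => A.η (y₁ i)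
  let b₂ : Fin n → V := fun i => A.η (y₂ i)
  have hee : p.prob A.e A.e ≠ 0 := by rw [hp.one.self]; exact one_ne_zero
  have hcross : ∀ u i, p.prob A.e u ≠ 0 → p.prob (A.f u) (x i) = 0 →
      inner ℝ (A.η u) (b₁ i) = 0 ∧ inner ℝ (A.η u) (b₂ i) = 0 := by
    intro u i hu h0
    have h := (hT i).conformal hp hu
    rw [h0, mul_zero] at h
    constructor <;> nlinarith [sq_nonneg (inner ℝ (A.η u) (A.η (y₁ i))),
      sq_nonneg (inner ℝ (A.η u) (A.η (y₂ i)))]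
  have hsurj : ∀ (c d : Fin n → ℝ) (s : Finset (Fin n)), ∃ u, p.prob A.e u ≠ 0 ∧
      A.η u = ∑ i ∈ s, (c i • b₁ i + d i • b₂ i) := by
    intro c d s
    induction s using Finset.induction_on with
    | empty => exact ⟨A.e, hee, by simp [A.η_e hp]⟩
    | insert j s hj ih =>
      obtain ⟨u, hu, hηu⟩ := ih
      obtain ⟨w, hw, hwj, hηw⟩ := (hT j).exists_η_eq hp (c j) (d j)
      rw [Finset.sum_insert hj, ← hηu, ← hηw]
      by_cases hue : A.e = u
      · exact ⟨w, hw, by rw [← hue, A.η_e hp, add_zero]⟩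
      by_cases hwe : A.e = w
      · exact ⟨u, hu, by rw [← hwe, A.η_e hp, zero_add]⟩
      refine A.exists_η_eq_add hp hw hu hwe hue ?_
      have h0 : inner ℝ (A.η u) (b₁ j) = 0 ∧ inner ℝ (A.η u) (b₂ j) = 0 := by
        have hz : ∀ i ∈ s, p.prob (x i) (x j) = 0 :=
          fun i hi => ho i j fun h => hj (h ▸ hi)
        have h1 : ∀ i ∈ s, inner ℝ (b₁ i) (b₁ j) = 0 ∧ inner ℝ (b₁ i) (b₂ j) = 0 := fun i hi =>
          hcross (y₁ i) j (hT i).prob_ne_zero (by rw [(hT i).f_y₁ hp, hz i hi])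
        have h2 : ∀ i ∈ s, inner ℝ (b₂ i) (b₁ j) = 0 ∧ inner ℝ (b₂ i) (b₂ j) = 0 := fun i hi =>
          hcross (y₂ i) j ((hT i).swap hp).prob_ne_zero
            (by rw [((hT i).swap hp).f_y₁ hp, hz i hi])
        rw [hηu]
        constructor
        · rw [sum_inner]
          refine Finset.sum_eq_zero fun i hi => ?_
          rw [inner_add_left, real_inner_smul_left, real_inner_smul_left, (h1 i hi).1,
            (h2 i hi).1, mul_zero, mul_zero, add_zero]
        · rw [sum_inner]
          refine Finset.sum_eq_zero fun i hi => ?_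
          rw [inner_add_left, real_inner_smul_left, real_inner_smul_left, (h1 i hi).2,
            (h2 i hi).2, mul_zero, mul_zero, add_zero]
      have h := (hT j).conformal hp hu
      rw [show A.η (y₁ j) = b₁ j from rfl, show A.η (y₂ j) = b₂ j from rfl, h0.1, h0.2] at h
      have hne : inner ℝ (A.η u) (A.η u) ≠ 0 := by
        rw [A.inner_η_self hp hu]
        refine div_ne_zero (fun h => hue (hp.one.eq (by linarith))) hu
      rw [A.f_eq hp (he j) hwj hwe, hp.one.symm]
      refine (mul_eq_zero.1 ?_).resolve_left hne
      rw [← h]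
      ring
  refine ⟨Submodule.span ℝ (Set.range (Sum.elim b₁ b₂)),
    FiniteDimensional.span_of_finite ℝ (Set.finite_range _), fun v => ⟨fun hv => ?_, ?_⟩⟩
  · obtain ⟨c, rfl⟩ := (Submodule.mem_span_range_iff_exists_fun ℝ).1 hv
    obtain ⟨u, hu, h⟩ := hsurj (fun i => c (Sum.inl i)) (fun i => c (Sum.inr i)) Finset.univ
    refine ⟨u, hu, ?_⟩
    rw [h, Fintype.sum_sum_type, Finset.sum_add_distrib]
    rfl
  · rintro ⟨u, hu, rfl⟩
    obtain ⟨w, hw, h⟩ := hsurj (fun i => inner ℝ (A.η u) (b₁ i)) (fun i => inner ℝ (A.η u) (b₂ i))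
      Finset.univ
    have hnorm : ∀ z, p.prob A.e z ≠ 0 → ∑ i, (inner ℝ (A.η z) (b₁ i) ^ 2 +
        inner ℝ (A.η z) (b₂ i) ^ 2) = inner ℝ (A.η z) (A.η z) := by
      intro z hz
      rw [Finset.sum_congr rfl fun i _ => (hT i).conformal hp hz, ← Finset.mul_sum]
      by_cases hze : A.e = z
      · rw [← hze, A.η_e hp, inner_zero_left, zero_mul]
      · have := hsum (A.f z)
        rw [A.prob_e_f z hze, zero_add, Finset.sum_congr rfl fun i _ => hp.one.symm (x i) (A.f z)]
          at this
        rw [this, mul_one]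
    -- Here w collects the components of η u. Parseval's identity for both gives ⟨η u, η w⟩ = |η u|²
    -- and |η w| ≤ |η u|, so the two vectors agree.
    have huw : inner ℝ (A.η u) (A.η w) = inner ℝ (A.η u) (A.η u) := by
      rw [h, inner_sum, ← hnorm u hu]
      refine Finset.sum_congr rfl fun i _ => ?_
      rw [inner_add_right, real_inner_smul_right, real_inner_smul_right]
      ring
    have hww : inner ℝ (A.η w) (A.η w) = ∑ i, (inner ℝ (A.η u) (b₁ i) * inner ℝ (A.η w) (b₁ i) +
        inner ℝ (A.η u) (b₂ i) * inner ℝ (A.η w) (b₂ i)) := by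
      nth_rewrite 2 [h]
      rw [inner_sum]
      refine Finset.sum_congr rfl fun i _ => ?_
      rw [inner_add_right, real_inner_smul_right, real_inner_smul_right]
    have hle : inner ℝ (A.η w) (A.η w) ≤ inner ℝ (A.η u) (A.η u) := by
      have : 0 ≤ ∑ i, ((inner ℝ (A.η u) (b₁ i) - inner ℝ (A.η w) (b₁ i)) ^ 2 +
          (inner ℝ (A.η u) (b₂ i) - inner ℝ (A.η w) (b₂ i)) ^ 2) :=
        Finset.sum_nonneg fun i _ => by positivity
      have e : ∑ i, ((inner ℝ (A.η u) (b₁ i) - inner ℝ (A.η w) (b₁ i)) ^ 2 +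
          (inner ℝ (A.η u) (b₂ i) - inner ℝ (A.η w) (b₂ i)) ^ 2) =
          inner ℝ (A.η u) (A.η u) + inner ℝ (A.η w) (A.η w) - 2 * inner ℝ (A.η w) (A.η w) := by
        nth_rewrite 2 [hww]
        rw [← hnorm u hu, ← hnorm w hw, ← Finset.sum_add_distrib, Finset.mul_sum,
          ← Finset.sum_sub_distrib]
        exact Finset.sum_congr rfl fun i _ => by ring
      linarith
    have huw' : A.η u = A.η w := by
      have h0 : 0 ≤ inner ℝ (A.η u - A.η w) (A.η u - A.η w) := real_inner_self_nonneg
      rw [inner_sub_left, inner_sub_right, inner_sub_right, real_inner_comm (A.η u) (A.η w)] at h0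
      exact eq_of_inner_sub_self_eq_zero (by linarith)
    rw [huw', h]
    refine Submodule.sum_mem _ fun i _ => Submodule.add_mem _
      (Submodule.smul_mem _ _ (Submodule.subset_span ⟨Sum.inl i, rfl⟩))
      (Submodule.smul_mem _ _ (Submodule.subset_span ⟨Sum.inr i, rfl⟩))

end Chart

end PTable

/-! ### The complex structure and the Born rule -/

namespace PTable

variable {S : Type*} {p : PTable S}

namespace Chart

variable {V : Type*} [NormedAddCommGroup V] [InnerProductSpace ℝ V] (A : p.Chart V)

/-- The range of the affine chart carries a complex structure that computes transition
probabilities. -/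
theorem exists_complexStructure (hp : p.Axioms) {U : Submodule ℝ V} [FiniteDimensional ℝ U]
    (hU : ∀ v, v ∈ U ↔ ∃ u, p.prob A.e u ≠ 0 ∧ A.η u = v) :
    ∃ J : U →ₗ[ℝ] U, (∀ v w, inner ℝ (J v) (J w) = inner ℝ v w) ∧
      (∀ v w, inner ℝ v (J w) = -inner ℝ (J v) w) ∧
      ∀ x y (u v : U), p.prob A.e x ≠ 0 → p.prob A.e y ≠ 0 → A.η x = u → A.η y = v →
        inner ℝ u v ^ 2 + inner ℝ u (J v) ^ 2 =
          inner ℝ u u * inner ℝ v v * p.prob (A.f x) (A.f y) := by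
  have hr : ∀ v : U, ∃ u, p.prob A.e u ≠ 0 ∧ A.η u = v := fun v => (hU v).1 v.2
  choose r hr0 hr using hr
  have hI : ∀ v : U, ∃ w : U, inner ℝ w w = inner ℝ v v ∧ ∀ x, p.prob A.e x ≠ 0 →
      inner ℝ (A.η x) (v : V) ^ 2 + inner ℝ (A.η x) (w : V) ^ 2 =
        inner ℝ (A.η x) (A.η x) * inner ℝ v v * p.prob (A.f x) (A.f (r v)) := by
    intro v
    obtain ⟨y, hy, h1, h2⟩ := A.exists_rotation hp (hr0 v)
    rw [hr] at h1 h2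
    exact ⟨⟨A.η y, (hU _).2 ⟨y, hy, rfl⟩⟩, h1, h2⟩
  -- The sense of the right-angle turn is chosen for each v separately, so I is controlled only up
  -- to signs.
  choose I hI1 hI2 using hI
  -- A point y with coordinate v may differ from the chosen `r v`; both are compared through a
  -- rotation of x instead.
  have hK : ∀ x y (u v : U), p.prob A.e x ≠ 0 → p.prob A.e y ≠ 0 → A.η x = u → A.η y = v →
      inner ℝ u v ^ 2 + inner ℝ u (I v) ^ 2 =
        inner ℝ u u * inner ℝ v v * p.prob (A.f x) (A.f y) := by
    intro x y u v hx hy hu hv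
    have h1 := hI2 v x hx
    obtain ⟨z, -, -, hz⟩ := A.exists_rotation hp hx
    have h2 := hz y hy
    have h3 := hz (r v) (hr0 v)
    rw [hr v, ← hv] at h3
    rw [hu, hv, hp.one.symm] at h2
    rw [hu, hv, hp.one.symm] at h3
    rw [hu] at h1
    simp only [Submodule.coe_inner] at h1 ⊢
    linear_combination h1 - h3 + h2
  have hsymm : ∀ u v : U, inner ℝ (I u) v ^ 2 = inner ℝ u (I v) ^ 2 := by
    intro u v
    have h1 := hK (r u) (r v) u v (hr0 u) (hr0 v) (hr u) (hr v)
    have h2 := hK (r v) (r u) v u (hr0 v) (hr0 u) (hr v) (hr u)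
    rw [hp.one.symm, real_inner_comm u v, real_inner_comm (I u) v] at h2
    linear_combination h2 - h1
  obtain ⟨J, hJ⟩ := exists_linearMap_eq_or_eq_neg I hsymm fun v hv h0 => hv (by
    rw [← inner_self_eq_zero (𝕜 := ℝ), ← hI1, h0, inner_zero_left])
  have hsq : ∀ u v : U, inner ℝ u (I v) ^ 2 = inner ℝ u (J v) ^ 2 := by
    intro u v
    rcases hJ v with h | h <;> rw [h]
    rw [inner_neg_right, neg_sq]
  have hJn : ∀ v, inner ℝ (J v) (J v) = inner ℝ v v := by
    intro v
    rw [← hI1 v]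
    rcases hJ v with h | h <;> rw [h]
    rw [inner_neg_neg]
  -- The case u = v, of probability 1; polarizing this and `hJn` makes J skew and isometric.
  have hJ0 : ∀ v, inner ℝ v (J v) = 0 := by
    intro v
    have h := hK (r v) (r v) v v (hr0 v) (hr0 v) (hr v) (hr v)
    rw [hsq, hp.one.self, mul_one, sq (inner ℝ v v), add_eq_left] at h
    exact pow_eq_zero_iff two_ne_zero |>.1 h
  refine ⟨J, fun v w => ?_, fun v w => ?_, fun x y u v hx hy hu hv => ?_⟩
  · have h := hJn (v + w)
    rw [map_add, real_inner_add_add_self, real_inner_add_add_self, hJn, hJn] at h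
    linarith
  · have h := hJ0 (v + w)
    rw [map_add, inner_add_left, inner_add_right, inner_add_right, hJ0, hJ0,
      real_inner_comm (J v) w] at h
    linarith
  · rw [← hsq]
    exact hK x y u v hx hy hu hv

end Chart

/-- The unit vectors of the Born rule, split into their component along `e` and the rest. -/
theorem Chart.exists_born {V : Type*} [NormedAddCommGroup V] [InnerProductSpace ℝ V]
    (A : p.Chart V) (hp : p.Axioms) {U : Submodule ℝ V} [FiniteDimensional ℝ U]
    (hU : ∀ v, v ∈ U ↔ ∃ u, p.prob A.e u ≠ 0 ∧ A.η u = v) {n : ℕ} {c : Fin n → S}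
    (he : ∀ i, p.prob A.e (c i) = 0) (hsum : ∀ z, p.prob A.e z + ∑ i, p.prob (c i) z = 1) :
    ∃ (a : S → ℝ) (θ : S → U) (J : U →ₗ[ℝ] U) (u : Fin n → U),
      (∀ v w, inner ℝ (J v) (J w) = inner ℝ v w) ∧
      (∀ v w, inner ℝ v (J w) = -inner ℝ (J v) w) ∧
      (∀ v, ∑ i, (inner ℝ v (u i) ^ 2 + inner ℝ v (J (u i)) ^ 2) = inner ℝ v v) ∧
      ∀ x y, p.prob x y = (a x * a y + inner ℝ (θ x) (θ y)) ^ 2 + inner ℝ (θ x) (J (θ y)) ^ 2 := by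
  classical
  obtain ⟨J, hJ1, hJ2, hK⟩ := A.exists_complexStructure hp hU
  -- A point g orthogonal to e lies at infinity. It is represented by a unit vector in its plane,
  -- the coordinate of a point on the equator of the qubit of e and g.
  have hex : ∀ g, ∃ (y : S) (v : U), p.prob A.e g = 0 →
      p.prob A.e y ≠ 0 ∧ A.f y = g ∧ A.η y = v ∧ inner ℝ v v = 1 := by
    intro g
    by_cases hg : p.prob A.e g = 0
    · obtain ⟨y₁, y₂, h⟩ := A.exists_isTriple hp hg
      exact ⟨y₁, ⟨A.η y₁, (hU _).2 ⟨y₁, h.prob_ne_zero, rfl⟩⟩, fun _ =>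
        ⟨h.prob_ne_zero, h.f_y₁ hp, rfl, h.inner_self hp⟩⟩
    · exact ⟨g, 0, fun h => absurd h hg⟩
  choose pt vec hpt using hex
  have hmem : ∀ x, A.η x ∈ U := by
    intro x
    by_cases hx : p.prob A.e x = 0
    · rw [A.η_of_prob_eq_zero hx]
      exact U.zero_mem
    · exact (hU _).2 ⟨x, hx, rfl⟩
  let η : S → U := fun x => ⟨A.η x, hmem x⟩
  have hη : ∀ x, p.prob A.e x ≠ 0 → p.prob A.e x * inner ℝ (η x) (η x) = 1 - p.prob A.e x := by
    intro x hx
    rw [show inner ℝ (η x) (η x) = (1 - p.prob A.e x) / p.prob A.e x from A.inner_η_self hp hx,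
      mul_div_cancel₀ _ hx]
  let a : S → ℝ := fun x => √(p.prob A.e x)
  have ha : ∀ x, a x ^ 2 = p.prob A.e x := fun x => Real.sq_sqrt (p.prob_nonneg _ _)
  -- The pair (a x, θ x) is (1, η x) scaled to length one, or (0, unit vector) at infinity.
  let θ : S → U := fun x => if p.prob A.e x = 0 then vec x else a x • η x
  have hswap : ∀ v w : U, inner ℝ v (J w) ^ 2 = inner ℝ w (J v) ^ 2 := by
    intro v w
    rw [hJ2 v w, neg_sq, real_inner_comm]
  have hmixed : ∀ x y, p.prob A.e x ≠ 0 → p.prob A.e y = 0 →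
      p.prob x y = (a x * a y + inner ℝ (θ x) (θ y)) ^ 2 + inner ℝ (θ x) (J (θ y)) ^ 2 := by
    intro x y hx hy
    obtain ⟨h1, h2, h3, h4⟩ := hpt y hy
    have h := hK x (pt y) (η x) (vec y) hx h1 rfl h3
    rw [h2, h4, mul_one] at h
    have hay : a y = 0 := by simp only [a, hy, Real.sqrt_zero]
    rw [A.prob_eq hp x hy, hay]
    simp only [θ, if_neg hx, if_pos hy, real_inner_smul_left]
    linear_combination -a x ^ 2 * h - inner ℝ (η x) (η x) * p.prob (A.f x) y * ha x -
      p.prob (A.f x) y * hη x hx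
  refine ⟨a, θ, J, fun i => vec (c i), hJ1, hJ2, fun v => ?_, fun x y => ?_⟩
  · obtain ⟨x, hx, hxv⟩ := (hU v).1 v.2
    have h : ∀ i, inner ℝ v (vec (c i)) ^ 2 + inner ℝ v (J (vec (c i))) ^ 2 =
        inner ℝ v v * p.prob (c i) (A.f x) := by
      intro i
      obtain ⟨h1, h2, h3, h4⟩ := hpt (c i) (he i)
      rw [hK x (pt (c i)) v _ hx h1 hxv h3, h4, h2, mul_one, hp.one.symm]
    rw [Finset.sum_congr rfl fun i _ => h i, ← Finset.mul_sum]
    by_cases hxe : A.e = x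
    · have : v = 0 := by rw [← Submodule.coe_eq_zero, ← hxv, ← hxe, A.η_e hp]
      rw [this, inner_zero_left, zero_mul]
    · have := hsum (A.f x)
      rw [A.prob_e_f x hxe, zero_add] at this
      rw [this, mul_one]
  · by_cases hx : p.prob A.e x = 0
    · by_cases hy : p.prob A.e y = 0
      · obtain ⟨h1, h2, h3, h4⟩ := hpt x hx
        obtain ⟨h1', h2', h3', h4'⟩ := hpt y hy
        have h := hK (pt x) (pt y) (vec x) (vec y) h1 h1' h3 h3'
        rw [h2, h2', h4, h4', mul_one, one_mul] at h
        have hay : a y = 0 := by simp only [a, hy, Real.sqrt_zero]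
        rw [← h, hay]
        simp only [θ, if_pos hx, if_pos hy]
        ring
      · rw [hp.one.symm x y, hmixed y x hy hx, hswap, real_inner_comm, mul_comm (a x)]
    · by_cases hy : p.prob A.e y = 0
      · exact hmixed x y hx hy
      · have h := hK x y (η x) (η y) hx hy rfl rfl
        have hi : 2 * p.prob A.e x * p.prob A.e y * inner ℝ (η x) (η y) = _ :=
          A.inner_η hp hx hy
        simp only [θ, if_neg hx, if_neg hy, real_inner_smul_left, real_inner_smul_right, map_smul]
        have e1 : (a x * a y + a y * (a x * inner ℝ (η x) (η y))) ^ 2 +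
            (a y * (a x * inner ℝ (η x) (J (η y)))) ^ 2 = a x ^ 2 * a y ^ 2 *
              (1 + 2 * inner ℝ (η x) (η y) +
                (inner ℝ (η x) (η y) ^ 2 + inner ℝ (η x) (J (η y)) ^ 2)) := by ring
        have e2 : p.prob x y = p.prob A.e x * p.prob A.e y * (1 + 2 * inner ℝ (η x) (η y)) +
            (p.prob A.e x * inner ℝ (η x) (η x)) * (p.prob A.e y * inner ℝ (η y) (η y)) *
              p.prob (A.f x) (A.f y) := by
          rw [hη x hx, hη y hy]
          linear_combination -hi
        rw [e1]
        rw [ha, ha, h, e2]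
        ring

end PTable

/-! ### Homogeneous coordinates in complex projective space -/

theorem norm_inner_unitRep_mk {N : ℕ} {v w : EuclideanSpace ℂ (Fin N)} (hv : ‖v‖ = 1)
    (hw : ‖w‖ = 1) (hv0 : v ≠ 0) (hw0 : w ≠ 0) :
    ‖inner ℂ (unitRep (Projectivization.mk ℂ v hv0)) (unitRep (Projectivization.mk ℂ w hw0))‖ =
      ‖inner ℂ v w‖ := by
  -- The chosen representative of a line is a scalar multiple of v; normalized, it differs from v by
  -- a phase, which the modulus ignores.
  have key : ∀ v : EuclideanSpace ℂ (Fin N), ‖v‖ = 1 → ∀ hv0 : v ≠ 0, ∃ c : ℂ, ‖c‖ = 1 ∧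
      unitRep (Projectivization.mk ℂ v hv0) = c • v := by
    intro v hv hv0
    obtain ⟨a, ha⟩ := Projectivization.exists_smul_eq_mk_rep ℂ v hv0
    have hn : ‖(Projectivization.mk ℂ v hv0).rep‖ = ‖(a : ℂ)‖ := by
      rw [← ha, Units.smul_def, norm_smul, hv, mul_one]
    refine ⟨((‖(Projectivization.mk ℂ v hv0).rep‖⁻¹ : ℝ) : ℂ) * a, ?_, ?_⟩
    · rw [norm_mul, Complex.norm_real, norm_inv, norm_norm, hn,
        inv_mul_cancel₀ (norm_ne_zero_iff.2 a.ne_zero)]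
    · rw [mul_smul, unitRep, ← Units.smul_def, ha]
  obtain ⟨a, ha, hva⟩ := key v hv hv0
  obtain ⟨b, hb, hwb⟩ := key w hw hw0
  rw [hva, hwb, inner_smul_left, inner_smul_right, norm_mul, norm_mul, RCLike.norm_conj, ha, hb,
    one_mul, one_mul]

/-- A skew isometry `J` and vectors `u i` such that the `u i` and `J (u i)` satisfy Parseval's
identity give complex coordinates. -/
theorem exists_complex_coordinates {U : Type*} [NormedAddCommGroup U] [InnerProductSpace ℝ U]
    {n : ℕ} {J : U →ₗ[ℝ] U} {u : Fin n → U} (hJ1 : ∀ v w, inner ℝ (J v) (J w) = inner ℝ v w)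
    (hJ2 : ∀ v w, inner ℝ v (J w) = -inner ℝ (J v) w)
    (hu : ∀ v, ∑ i, (inner ℝ v (u i) ^ 2 + inner ℝ v (J (u i)) ^ 2) = inner ℝ v v) :
    ∃ ψ : ℝ → U → EuclideanSpace ℂ (Fin (n + 1)), ∀ a b v w,
      ‖inner ℂ (ψ a v) (ψ b w)‖ ^ 2 = (a * b + inner ℝ v w) ^ 2 + inner ℝ v (J w) ^ 2 := by
  have hpol : ∀ v w, ∑ i, (inner ℝ v (u i) * inner ℝ w (u i) +
      inner ℝ v (J (u i)) * inner ℝ w (J (u i))) = inner ℝ v w := by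
    intro v w
    have h := hu (v + w)
    rw [real_inner_add_add_self, ← hu v, ← hu w] at h
    have h' : ∑ i, (inner ℝ (v + w) (u i) ^ 2 + inner ℝ (v + w) (J (u i)) ^ 2) =
        ∑ i, (inner ℝ v (u i) ^ 2 + inner ℝ v (J (u i)) ^ 2) +
        2 * ∑ i, (inner ℝ v (u i) * inner ℝ w (u i) +
          inner ℝ v (J (u i)) * inner ℝ w (J (u i))) +
        ∑ i, (inner ℝ w (u i) ^ 2 + inner ℝ w (J (u i)) ^ 2) := by
      rw [Finset.mul_sum, ← Finset.sum_add_distrib, ← Finset.sum_add_distrib]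
      refine Finset.sum_congr rfl fun i _ => ?_
      rw [inner_add_left, inner_add_left]
      ring
    linarith
  -- In these coordinates J is multiplication by i, as J is a skew isometry. The extra coordinate of
  -- ψ is the component along e.
  let z : U → Fin n → ℂ := fun v i => ⟨inner ℝ v (u i), inner ℝ v (J (u i))⟩
  let ψ : ℝ → U → EuclideanSpace ℂ (Fin (n + 1)) :=
    fun a v => WithLp.toLp 2 (Fin.cons (a : ℂ) (z v))
  have hin : ∀ a b v w, inner ℂ (ψ a v) (ψ b w) =
      (a : ℂ) * b + ∑ i, (starRingEnd ℂ) (z v i) * z w i := by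
    intro a b v w
    simp [ψ, PiLp.inner_apply, Fin.sum_univ_succ, mul_comm]
  refine ⟨ψ, fun a b v w => ?_⟩
  have hre : (inner ℂ (ψ a v) (ψ b w)).re = a * b + inner ℝ v w := by
    rw [hin, ← hpol v w]
    simp [z]
  have him : (inner ℂ (ψ a v) (ψ b w)).im = -inner ℝ v (J w) := by
    rw [hin, ← hpol v (J w), ← Finset.sum_neg_distrib]
    simp only [Complex.add_im, Complex.mul_im, Complex.ofReal_re, Complex.ofReal_im, mul_zero,
      zero_mul, add_zero, zero_add, Complex.im_sum, Complex.conj_re, Complex.conj_im, z]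
    refine Finset.sum_congr rfl fun i _ => ?_
    have e : inner ℝ (J w) (u i) = -inner ℝ w (J (u i)) := by rw [hJ2 w, neg_neg]
    rw [e, hJ1]
    ring
  rw [Complex.sq_norm, Complex.normSq_apply, hre, him]
  ring

theorem mainTheorem1 {S : Type*} (p : PTable S)
    (h1 : p.AxiomI) (h2 : p.AxiomII) (h3 : p.AxiomIII) (h4 : p.AxiomIV) (h5 : p.AxiomV) :
    (∃ N : ℕ, p.HasDimension N) ∧
      ∀ N : ℕ, p.HasDimension N →
        ∃ φ : S → ℙ ℂ (EuclideanSpace ℂ (Fin N)),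
          ∀ x y : S, p.prob x y = ‖inner ℂ (unitRep (φ x)) (unitRep (φ y))‖ ^ 2 := by
  refine ⟨PTable.exists_hasDimension h1 h2 h3, fun N => ?_⟩
  rintro ⟨c, ho, hsum⟩
  cases N with
  | zero =>
    have : IsEmpty S := ⟨fun z => by simpa using hsum z⟩
    exact ⟨isEmptyElim, isEmptyElim⟩
  | succ n =>
    have hp : p.Axioms := ⟨h1, h2, h3, h4, h5⟩
    obtain ⟨V, _, _, ι, hι⟩ := PTable.exists_featureMap h1 h2 h3 h4
    obtain ⟨A, hA⟩ := hp.exists_chart hι (c 0)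
    have he : ∀ i : Fin n, p.prob A.e (c i.succ) = 0 := fun i => by
      rw [hA]
      exact ho _ _ (Fin.succ_ne_zero i).symm
    have hs : ∀ z, p.prob A.e z + ∑ i : Fin n, p.prob (c i.succ) z = 1 := fun z => by
      rw [hA, ← Fin.sum_univ_succ fun i => p.prob (c i) z]
      exact hsum z
    obtain ⟨U, _, hU⟩ := A.exists_range_eq hp
      (fun i j hij => ho i.succ j.succ fun h => hij (Fin.succ_injective _ h)) he hs
    obtain ⟨a, θ, J, u, hJ1, hJ2, hu, hb⟩ := A.exists_born hp hU he hs
    obtain ⟨ψ, hψ⟩ := exists_complex_coordinates hJ1 hJ2 hu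
    have hborn : ∀ x y, p.prob x y = ‖inner ℂ (ψ (a x) (θ x)) (ψ (a y) (θ y))‖ ^ 2 := fun x y =>
      (hb x y).trans (hψ _ _ _ _).symm
    have hnorm : ∀ x, ‖ψ (a x) (θ x)‖ = 1 := by
      intro x
      have h := hborn x x
      rw [h1.self, inner_self_eq_norm_sq_to_K, norm_pow, RCLike.norm_ofReal, abs_norm, ← pow_mul]
        at h
      exact (pow_eq_one_iff_of_nonneg (norm_nonneg _) (by norm_num)).1 h.symm
    have hne : ∀ x, ψ (a x) (θ x) ≠ 0 := fun x h => by
      have := hnorm x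
      rw [h, norm_zero] at this
      exact zero_ne_one this
    refine ⟨fun x => Projectivization.mk ℂ _ (hne x), fun x y => ?_⟩
    rw [norm_inner_unitRep_mk (hnorm x) (hnorm y)]
    exact hborn x y
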